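/- Let $k$ be an algebraically closed field of characteristic zero and let $X\subseteq\mathbb{P}^N_k$ be a nonsingular projective variety (integral closed subvariety) of positive dimension. Put $\mathcal{L}=\mathcal{O}_X(1)$. Assume that $X$ is embedded by the complete linear system of $\mathcal{L}$, i.e. every global section of $\mathcal{L}$ is the restriction of a linear form on $\mathbb{P}^N$, and that $\mathcal{L}$ is $5$-very ample, i.e. for every zero-dimensional subscheme $Z\subseteq X$ of length at most $6$ the restriction map $H^0(X,\mathcal{L})\to H^0(X,\mathcal{L}\otimes\mathcal{O}_Z)$ is surjective. For $r\ge 1$ let $\sigma_r(X)\subseteq\mathbb{P}^N$ be the $r$-secant variety, the Zariski closure of the union of the linear subspaces spanned by $r$ points of $X$. Let $Y=\sigma_2(X)$, let $J=J(X,Y)=\operatorname{Proj}(S_X\otimes_k S_Y)$ be the ruled join, where $S_X$, $S_Y$ are the homogeneous coordinate rings of $X$, $Y$, and let $XY\subseteq\mathbb{P}^N$ be the embedded join, the Zariski closure of the union of the lines joining a point of $X$ to a point of $Y$. Then $XY=\sigma_3(X)$, and the dominant rational map $$J(X,Y)\dashrightarrow XY,\qquad [x_0:\dots:x_N:y_0:\dots:y_N]\mapsto[x_0-y_0:\dots:x_N-y_N],$$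 has degree $3$, i.e. $[k(J):k(XY)]=3$. -/

import Mathlib

open scoped LinearAlgebra.Projectivization TensorProduct

noncomputable section

/-! ## Function fields of graded domains and degrees of rational maps -/

namespace GradedDomain

variable {k R R' : Type*} [Field k] [CommRing R] [IsDomain R] [Algebra k R]
  [CommRing R'] [IsDomain R'] [Algebra k R']

/-- The function field of `Proj R`, for a graded domain `R = ⨁ 𝒜 n`: the field of the quotients
`a / b` of homogeneous elements of the same degree, inside the fraction field of `R`. -/
def functionField (𝒜 : ℕ → Submodule k R) [SetLike.GradedMonoid 𝒜] :
    Subfield (FractionRing R) where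
  carrier := {z | ∃ n, ∃ a ∈ 𝒜 n, ∃ b ∈ 𝒜 n, b ≠ 0 ∧
    z = algebraMap R (FractionRing R) a / algebraMap R (FractionRing R) b}
  one_mem' := ⟨0, 1, SetLike.GradedOne.one_mem, 1, SetLike.GradedOne.one_mem, one_ne_zero, by simp⟩
  zero_mem' := ⟨0, 0, zero_mem _, 1, SetLike.GradedOne.one_mem, one_ne_zero, by simp⟩
  mul_mem' := by
    rintro _ _ ⟨n, a, ha, b, hb, h0, rfl⟩ ⟨m, c, hc, d, hd, h1, rfl⟩
    refine ⟨n + m, a * c, SetLike.GradedMul.mul_mem ha hc, b * d,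
      SetLike.GradedMul.mul_mem hb hd, mul_ne_zero h0 h1, ?_⟩
    rw [map_mul, map_mul, div_mul_div_comm]
  add_mem' := by
    rintro _ _ ⟨n, a, ha, b, hb, h0, rfl⟩ ⟨m, c, hc, d, hd, h1, rfl⟩
    refine ⟨n + m, a * d + b * c, add_mem (SetLike.GradedMul.mul_mem ha hd)
      (SetLike.GradedMul.mul_mem hb hc), b * d, SetLike.GradedMul.mul_mem hb hd,
      mul_ne_zero h0 h1, ?_⟩
    rw [div_add_div _ _ (by simpa using h0) (by simpa using h1)]
    simp
  neg_mem' := by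
    rintro _ ⟨n, a, ha, b, hb, h0, rfl⟩
    exact ⟨n, -a, neg_mem ha, b, hb, h0, by simp [neg_div]⟩
  inv_mem' := by
    rintro _ ⟨n, a, ha, b, hb, h0, rfl⟩
    by_cases h : a = 0
    · exact ⟨0, 0, zero_mem _, 1, SetLike.GradedOne.one_mem, one_ne_zero, by simp [h]⟩
    · exact ⟨n, b, hb, a, ha, h, by simp⟩

variable (𝒜 : ℕ → Submodule k R) [SetLike.GradedMonoid 𝒜]
  (ℬ : ℕ → Submodule k R') [SetLike.GradedMonoid ℬ]

/-- The pull-back `a / b ↦ φ a / φ b` of rational functions along the dominant rational map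
`Proj R' ⇢ Proj R` given by an injective homomorphism `φ : R → R'` of graded domains. -/
def pullback (φ : R →ₐ[k] R') (hφ : Function.Injective φ) (hgr : ∀ n, ∀ a ∈ 𝒜 n, φ a ∈ ℬ n) :
    functionField 𝒜 →+* functionField ℬ :=
  ((IsFractionRing.map (K := FractionRing R) (L := FractionRing R') (j := φ.toRingHom) hφ).comp
    (functionField 𝒜).subtype).codRestrict (functionField ℬ).toSubring (by
      rintro ⟨_, n, a, ha, b, hb, h0, rfl⟩
      refine ⟨n, φ a, hgr n a ha, φ b, hgr n b hb, fun h => h0 (hφ (by simpa using h)), ?_⟩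
      simp [IsFractionRing.map])

/-- The degree of the dominant rational map `Proj R' ⇢ Proj R` given by an injective homomorphism
`φ : R → R'` of graded domains: the degree of the extension of function fields. (The value `0`
stands for an infinite extension.) -/
def rationalMapDegree (φ : R →ₐ[k] R') (hφ : Function.Injective φ)
    (hgr : ∀ n, ∀ a ∈ 𝒜 n, φ a ∈ ℬ n) : ℕ :=
  letI : Algebra (functionField 𝒜) (functionField ℬ) := (pullback 𝒜 ℬ φ hφ hgr).toAlgebra
  Module.finrank (functionField 𝒜) (functionField ℬ)

end GradedDomain

/-! ## Projective varieties -/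

section

attribute [local instance] MvPolynomial.gradedAlgebra

/-- A (nonempty, irreducible, reduced) closed subvariety of `ℙ^N`, given by its homogeneous prime
ideal, which is not to contain the irrelevant ideal. -/
structure ProjectiveVariety (k : Type*) [Field k] (N : ℕ) where
  ideal : Ideal (MvPolynomial (Fin (N + 1)) k)
  isHomogeneous : ideal.IsHomogeneous (MvPolynomial.homogeneousSubmodule (Fin (N + 1)) k)
  isPrime : ideal.IsPrime
  exists_X_notMem : ∃ i, MvPolynomial.X i ∉ ideal

end

namespace ProjectiveVariety

variable {k : Type*} [Field k] {N : ℕ}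

instance (X : ProjectiveVariety k N) : X.ideal.IsPrime := X.isPrime

/-- The `k`-points of the affine cone over `X`. -/
def cone (X : ProjectiveVariety k N) : Set (Fin (N + 1) → k) := MvPolynomial.zeroLocus k X.ideal

/-- The `k`-points of `X` in projective space. -/
def points (X : ProjectiveVariety k N) : Set (ℙ k (Fin (N + 1) → k)) := {p | p.rep ∈ X.cone}

/-- The homogeneous coordinate ring. -/
def coordRing (X : ProjectiveVariety k N) : Type _ := MvPolynomial (Fin (N + 1)) k ⧸ X.ideal

instance (X : ProjectiveVariety k N) : CommRing X.coordRing :=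
  inferInstanceAs (CommRing (MvPolynomial (Fin (N + 1)) k ⧸ X.ideal))

instance (X : ProjectiveVariety k N) : Algebra k X.coordRing :=
  inferInstanceAs (Algebra k (MvPolynomial (Fin (N + 1)) k ⧸ X.ideal))

instance (X : ProjectiveVariety k N) : IsDomain X.coordRing :=
  inferInstanceAs (IsDomain (MvPolynomial (Fin (N + 1)) k ⧸ X.ideal))

/-- The quotient map from the polynomial ring to the homogeneous coordinate ring. -/
def toCoordRing (X : ProjectiveVariety k N) : MvPolynomial (Fin (N + 1)) k →ₐ[k] X.coordRing :=
  Ideal.Quotient.mkₐ k X.ideal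

theorem toCoordRing_surjective (X : ProjectiveVariety k N) : Function.Surjective X.toCoordRing :=
  Ideal.Quotient.mk_surjective

theorem toCoordRing_eq_zero_iff (X : ProjectiveVariety k N) (f : MvPolynomial (Fin (N + 1)) k) :
    X.toCoordRing f = 0 ↔ f ∈ X.ideal := Ideal.Quotient.eq_zero_iff_mem

/-- The homogeneous elements of degree `n` of the homogeneous coordinate ring. -/
def piece (X : ProjectiveVariety k N) (n : ℕ) : Submodule k X.coordRing :=
  (MvPolynomial.homogeneousSubmodule (Fin (N + 1)) k n).map X.toCoordRing.toLinearMap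

instance (X : ProjectiveVariety k N) : SetLike.GradedMonoid X.piece where
  one_mem := ⟨1, MvPolynomial.isHomogeneous_one _ _, by simp⟩
  mul_mem := by
    rintro i j _ _ ⟨a, ha, rfl⟩ ⟨b, hb, rfl⟩
    exact ⟨a * b, MvPolynomial.IsHomogeneous.mul ha hb, by simp⟩

/-- The coordinate functions `x_i` on the cone over `X`. -/
def coord (X : ProjectiveVariety k N) (i : Fin (N + 1)) : X.coordRing :=
  X.toCoordRing (MvPolynomial.X i)

/-! ### Sections of `𝒪_X(1)`, nonsingularity, and higher very ampleness -/

/-- The ring of regular functions on the affine open set `D(h) ⊆ X` where the linear form `h ≠ 0`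
does not vanish, as a subring of the fraction field of the homogeneous coordinate ring:
it consists of the fractions `f / h ^ m` with `f` homogeneous of degree `m`. -/
def chartRing (X : ProjectiveVariety k N) (h : X.piece 1) :
    Subalgebra k (FractionRing X.coordRing) where
  carrier := {z | ∃ m, ∃ f ∈ X.piece m, z * algebraMap _ _ (h : X.coordRing) ^ m =
    algebraMap X.coordRing (FractionRing X.coordRing) f}
  mul_mem' := by
    rintro a b ⟨m, f, hf, e⟩ ⟨n, g, hg, e'⟩
    refine ⟨m + n, f * g, SetLike.GradedMul.mul_mem hf hg, ?_⟩
    rw [map_mul, ← e, ← e']; ring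
  add_mem' := by
    rintro a b ⟨m, f, hf, e⟩ ⟨n, g, hg, e'⟩
    have hp : ∀ r : ℕ, (h : X.coordRing) ^ r ∈ X.piece r := fun r => by
      simpa using SetLike.pow_mem_graded r h.2
    refine ⟨m + n, f * (h : X.coordRing) ^ n + (h : X.coordRing) ^ m * g,
      add_mem (SetLike.GradedMul.mul_mem hf (hp n)) (SetLike.GradedMul.mul_mem (hp m) hg), ?_⟩
    rw [map_add, map_mul, map_mul, map_pow, map_pow, ← e, ← e']; ring
  algebraMap_mem' r := by
    refine ⟨0, algebraMap k X.coordRing r, ?_, ?_⟩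
    · rw [Algebra.algebraMap_eq_smul_one]
      exact Submodule.smul_mem _ _ SetLike.GradedOne.one_mem
    · rw [pow_zero, mul_one, ← IsScalarTower.algebraMap_apply]

/-- `X` is nonsingular: all its local rings, that is, the localizations of the rings of regular
functions on the affine open sets `D(h)` at prime ideals, are regular. -/
def IsNonsingular (X : ProjectiveVariety k N) : Prop :=
  ∀ h : X.piece 1, h ≠ 0 → IsRegularRing (X.chartRing h)

/-- The space `H⁰(X, 𝒪_X(1))` of global sections: the `s` in the fraction field of the
homogeneous coordinate ring such that `s / h` is a regular function on `D(h)` for each linear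
form `h ≠ 0` (on `D(h)`, the line bundle `𝒪_X(1)` is free with basis `h`). -/
def sections (X : ProjectiveVariety k N) : Submodule k (FractionRing X.coordRing) where
  carrier := {s | ∀ h : X.piece 1, h ≠ 0 →
    s / algebraMap X.coordRing (FractionRing X.coordRing) h ∈ X.chartRing h}
  add_mem' {a b} ha hb h h0 := by rw [add_div]; exact add_mem (ha h h0) (hb h h0)
  zero_mem' h _ := by rw [zero_div]; exact zero_mem _
  smul_mem' c s hs h h0 := by
    rw [smul_div_assoc]; exact Subalgebra.smul_mem _ (hs h h0) c

/-- The embedding `X ⊆ ℙ^N` is given by the complete linear system of `𝒪_X(1)`: every global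
section of `𝒪_X(1)` is the restriction of a linear form. -/
def IsCompletelyEmbedded (X : ProjectiveVariety k N) : Prop :=
  ∀ s ∈ X.sections, ∃ l ∈ X.piece 1, s = algebraMap X.coordRing (FractionRing X.coordRing) l

/-- The restriction of global sections of `𝒪_X(1)` to a closed subscheme `Z` of `D(h)` given by
an ideal `J` of the ring of regular functions on `D(h)`. The sections of `𝒪_X(1) ⊗ 𝒪_Z` are
identified with the elements of `𝒪(D(h)) ⧸ J` through the basis `h` of `𝒪_X(1)` on `D(h)`. -/
def restrict (X : ProjectiveVariety k N) (h : X.piece 1) (h0 : h ≠ 0)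
    (J : Ideal (X.chartRing h)) : X.sections →ₗ[k] X.chartRing h ⧸ J :=
  (Ideal.Quotient.mkₐ k J).toLinearMap ∘ₗ
    { toFun := fun s => ⟨(s : FractionRing X.coordRing) /
        algebraMap X.coordRing (FractionRing X.coordRing) h, s.2 h h0⟩
      map_add' := fun _ _ => Subtype.ext (add_div _ _ _)
      map_smul' := fun _ _ => Subtype.ext (smul_div_assoc _ _ _) }

/-- `𝒪_X(1)` is `d`-very ample: for every zero-dimensional subscheme `Z` of `X` of length at most
`d + 1`, the restriction map `H⁰(X, 𝒪_X(1)) → H⁰(X, 𝒪_X(1) ⊗ 𝒪_Z)` is surjective. (The field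
being infinite, each such `Z` lies in some `D(h)`, so that it is given by an ideal of finite
codimension in the ring of regular functions on `D(h)`.) -/
def IsVeryAmple (X : ProjectiveVariety k N) (d : ℕ) : Prop :=
  ∀ (h : X.piece 1) (h0 : h ≠ 0) (J : Ideal (X.chartRing h)),
    Module.Finite k (X.chartRing h ⧸ J) → Module.finrank k (X.chartRing h ⧸ J) ≤ d + 1 →
      Function.Surjective (X.restrict h h0 J)

/-! ### Joins and secant varieties -/

/-- The ideal of all polynomials that vanish at (all representatives of) the points of `T`; it
defines the Zariski closure of `T`. -/
def vanishingIdeal (T : Set (ℙ k (Fin (N + 1) → k))) : Ideal (MvPolynomial (Fin (N + 1)) k) :=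
  MvPolynomial.vanishingIdeal k {v | ∃ hv : v ≠ 0, Projectivization.mk k v hv ∈ T}

/-- The union of the linear subspaces of `ℙ^N` spanned by points `p i ∈ X i`. -/
def spans {ι : Type*} (X : ι → ProjectiveVariety k N) : Set (ℙ k (Fin (N + 1) → k)) :=
  {q | ∃ p : ι → ℙ k (Fin (N + 1) → k), (∀ i, p i ∈ (X i).points) ∧
    q.submodule ≤ ⨆ i, (p i).submodule}

section Helpers

theorem aeval_smul_of_isHomogeneous {f : MvPolynomial (Fin (N + 1)) k} {n : ℕ}
    (hf : f.IsHomogeneous n) (c : k) (v : Fin (N + 1) → k) :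
    MvPolynomial.aeval (c • v) f = c ^ n * MvPolynomial.aeval v f := by
  rw [MvPolynomial.aeval_def, MvPolynomial.aeval_def, MvPolynomial.eval₂_eq,
    MvPolynomial.eval₂_eq, Finset.mul_sum]
  refine Finset.sum_congr rfl fun d hd => ?_
  have : ∑ i ∈ d.support, d i = n := by
    have := hf (MvPolynomial.mem_support_iff.1 hd)
    simpa [Finsupp.weight_apply, Finsupp.sum] using this
  simp only [Pi.smul_apply, smul_eq_mul, mul_pow, Finset.prod_mul_distrib]
  rw [Finset.prod_pow_eq_pow_sum, this]
  ring

theorem smul_mem_cone (X : ProjectiveVariety k N) (c : k) {v : Fin (N + 1) → k}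
    (hv : v ∈ X.cone) : c • v ∈ X.cone := by
  intro f hf
  rw [← MvPolynomial.sum_homogeneousComponent f, map_sum]
  refine Finset.sum_eq_zero fun n _ => ?_
  rw [aeval_smul_of_isHomogeneous (MvPolynomial.homogeneousComponent_isHomogeneous n f)]
  rw [hv _ (MvPolynomial.homogeneousComponent_mem_of_mem X.isHomogeneous hf n), mul_zero]

theorem mk_mem_points (X : ProjectiveVariety k N) {v : Fin (N + 1) → k} (hv : v ∈ X.cone)
    (h0 : v ≠ 0) : Projectivization.mk k v h0 ∈ X.points := by
  obtain ⟨a, ha⟩ := Projectivization.exists_smul_eq_mk_rep k v h0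
  change (Projectivization.mk k v h0).rep ∈ X.cone
  rw [← ha]
  exact X.smul_mem_cone _ hv

variable [IsAlgClosed k]

theorem mem_ideal_iff (X : ProjectiveVariety k N) (f : MvPolynomial (Fin (N + 1)) k) :
    f ∈ X.ideal ↔ ∀ v ∈ X.cone, MvPolynomial.aeval v f = 0 := by
  have := MvPolynomial.vanishingIdeal_zeroLocus_eq_radical (K := k) X.ideal
  rw [X.isPrime.radical] at this
  conv_lhs => rw [← this]
  rfl

theorem exists_cone_ne_zero (X : ProjectiveVariety k N) : ∃ v ∈ X.cone, v ≠ 0 := by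
  obtain ⟨i, hi⟩ := X.exists_X_notMem
  rw [mem_ideal_iff] at hi
  push Not at hi
  obtain ⟨v, hv, h⟩ := hi
  exact ⟨v, hv, fun h' => h (by simp [h'])⟩

theorem exists_common (X : ProjectiveVariety k N) (u w : Fin (N + 1) → k)
    (f g : MvPolynomial (Fin (N + 1)) k)
    (hf : ∃ v ∈ X.cone, MvPolynomial.aeval (v + u) f ≠ 0)
    (hg : ∃ v ∈ X.cone, MvPolynomial.aeval (v + w) g ≠ 0) :
    ∃ v ∈ X.cone, MvPolynomial.aeval (v + u) f ≠ 0 ∧ MvPolynomial.aeval (v + w) g ≠ 0 := by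
  have key : ∀ (t : Fin (N + 1) → k) (p : MvPolynomial (Fin (N + 1)) k) (v : Fin (N + 1) → k),
      MvPolynomial.aeval v (MvPolynomial.aeval
        (fun i => MvPolynomial.X i + MvPolynomial.C (t i)) p) = MvPolynomial.aeval (v + t) p := by
    intro t p v
    rw [← AlgHom.comp_apply]
    congr 1
    ext i
    simp
  by_contra! hcon
  have : MvPolynomial.aeval (fun i => MvPolynomial.X i + MvPolynomial.C (u i)) f *
      MvPolynomial.aeval (fun i => MvPolynomial.X i + MvPolynomial.C (w i)) g ∈ X.ideal := by
    rw [mem_ideal_iff]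
    intro v hv
    rw [map_mul, key, key]
    by_cases h : MvPolynomial.aeval (v + u) f = 0
    · simp [h]
    · simp [hcon v hv h]
  rcases X.isPrime.mem_or_mem this with h | h <;> rw [mem_ideal_iff] at h
  · obtain ⟨v, hv, h'⟩ := hf
    exact h' (by rw [← key]; exact h v hv)
  · obtain ⟨v, hv, h'⟩ := hg
    exact h' (by rw [← key]; exact h v hv)

theorem exists_common_sum {ι : Type*} (s : Finset ι) (X : ι → ProjectiveVariety k N)
    (f g : MvPolynomial (Fin (N + 1)) k) (a b : ι → Fin (N + 1) → k)
    (ha : ∀ i, a i ∈ (X i).cone) (hb : ∀ i, b i ∈ (X i).cone) (u w : Fin (N + 1) → k)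
    (hf : MvPolynomial.aeval (∑ i ∈ s, a i + u) f ≠ 0)
    (hg : MvPolynomial.aeval (∑ i ∈ s, b i + w) g ≠ 0) :
    ∃ c : ι → Fin (N + 1) → k, (∀ i, c i ∈ (X i).cone) ∧
      MvPolynomial.aeval (∑ i ∈ s, c i + u) f ≠ 0 ∧
      MvPolynomial.aeval (∑ i ∈ s, c i + w) g ≠ 0 := by
  classical
  induction s using Finset.induction_on generalizing u w with
  | empty => exact ⟨a, ha, by simpa using hf, by simpa using hg⟩
  | insert j s hj ih =>
    rw [Finset.sum_insert hj, add_assoc] at hf hg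
    obtain ⟨v, hv, h1, h2⟩ := (X j).exists_common (∑ i ∈ s, a i + u) (∑ i ∈ s, b i + w) f g
      ⟨_, ha j, hf⟩ ⟨_, hb j, hg⟩
    obtain ⟨c, hc, h3, h4⟩ := ih (v + u) (v + w) (by rwa [add_left_comm])
      (by rwa [add_left_comm])
    refine ⟨Function.update c j v, fun i => ?_, ?_⟩
    · by_cases h : i = j
      · subst h; simpa using hv
      · simpa [h] using hc i
    · have e : ∑ i ∈ s, Function.update c j v i = ∑ i ∈ s, c i :=
        Finset.sum_congr rfl fun i hi => by
          rw [Function.update_of_ne]; rintro rfl; exact hj hi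
      rw [Finset.sum_insert hj, e, Function.update_self, add_assoc, add_assoc,
        add_left_comm, add_left_comm v]
      exact ⟨h3, h4⟩


theorem mk_mem_spans_iff {ι : Type*} [Fintype ι] (X : ι → ProjectiveVariety k N)
    {v : Fin (N + 1) → k} (hv : v ≠ 0) : Projectivization.mk k v hv ∈ spans X ↔
      ∃ c : ι → Fin (N + 1) → k, (∀ i, c i ∈ (X i).cone) ∧ v = ∑ i, c i := by
  classical
  constructor
  · rintro ⟨p, hp, h⟩
    rw [Projectivization.submodule_mk, Submodule.span_singleton_le_iff_mem,
      Submodule.mem_iSup_iff_exists_finsupp] at h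
    obtain ⟨f, hf, rfl⟩ := h
    refine ⟨f, fun i => ?_, Finsupp.sum_fintype _ _ (by simp)⟩
    have := hf i
    rw [Projectivization.submodule_eq, Submodule.mem_span_singleton] at this
    obtain ⟨a, ha⟩ := this
    rw [← ha]
    exact (X i).smul_mem_cone _ (hp i)
  · rintro ⟨c, hc, e⟩
    choose u hu hu0 using fun i => (X i).exists_cone_ne_zero
    have hex : ∀ i, ∃ p ∈ (X i).points, c i ∈ p.submodule := fun i => by
      by_cases h : c i = 0
      · exact ⟨_, (X i).mk_mem_points (hu i) (hu0 i), by simp [h]⟩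
      · refine ⟨_, (X i).mk_mem_points (hc i) h, ?_⟩
        rw [Projectivization.submodule_mk]
        exact Submodule.mem_span_singleton_self _
    choose p hp hcp using hex
    refine ⟨p, hp, ?_⟩
    rw [Projectivization.submodule_mk, Submodule.span_singleton_le_iff_mem, e]
    exact Submodule.sum_mem _ fun i _ => Submodule.mem_iSup_of_mem i (hcp i)

theorem mem_vanishingIdeal_spans_iff {ι : Type*} [Fintype ι] (X : ι → ProjectiveVariety k N)
    (f : MvPolynomial (Fin (N + 1)) k) : f ∈ vanishingIdeal (spans X) ↔
      ∀ c : ι → Fin (N + 1) → k, (∀ i, c i ∈ (X i).cone) → ∑ i, c i ≠ 0 →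
        MvPolynomial.aeval (∑ i, c i) f = 0 := by
  constructor
  · exact fun h c hc h0 => h _ ⟨h0, (mk_mem_spans_iff X h0).2 ⟨c, hc, rfl⟩⟩
  · rintro h v ⟨h0, hv⟩
    obtain ⟨c, hc, rfl⟩ := (mk_mem_spans_iff X h0).1 hv
    exact h c hc h0

theorem exists_sum_ne_zero {ι : Type*} [Fintype ι] [Nonempty ι] (X : ι → ProjectiveVariety k N) :
    ∃ c : ι → Fin (N + 1) → k, (∀ i, c i ∈ (X i).cone) ∧ ∑ i, c i ≠ 0 := by
  classical
  obtain ⟨j⟩ := ‹Nonempty ι›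
  obtain ⟨v, hv, h0⟩ := (X j).exists_cone_ne_zero
  refine ⟨Pi.single j v, fun i => ?_, by simpa [Finset.sum_pi_single'] using h0⟩
  by_cases h : i = j
  · subst h; simpa using hv
  · obtain ⟨w, hw, _⟩ := (X i).exists_cone_ne_zero
    simpa [h] using (X i).smul_mem_cone 0 hw

attribute [local instance] MvPolynomial.gradedAlgebra in
theorem vanishingIdeal_isHomogeneous (T : Set (ℙ k (Fin (N + 1) → k))) :
    (vanishingIdeal T).IsHomogeneous (MvPolynomial.homogeneousSubmodule (Fin (N + 1)) k) := by
  intro n f hf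
  change (MvPolynomial.decomposition.decompose' f n : MvPolynomial (Fin (N + 1)) k) ∈ _
  rw [MvPolynomial.decomposition.decompose'_apply]
  rintro v ⟨hv, hT⟩
  set q : Polynomial k := ∑ m ∈ Finset.range (f.totalDegree + 1),
    Polynomial.monomial m (MvPolynomial.aeval v (MvPolynomial.homogeneousComponent m f)) with hq
  have hq0 : q = 0 := by
    refine Polynomial.eq_zero_of_infinite_isRoot _
      (Set.Infinite.mono ?_ (Set.finite_singleton (0 : k)).infinite_compl)
    intro c hc
    have hc' : c ≠ 0 := hc
    have h1 : MvPolynomial.aeval (c • v) f = 0 := by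
      refine hf _ ⟨smul_ne_zero hc' hv, ?_⟩
      rwa [(Projectivization.mk_eq_mk_iff' k (c • v) v (smul_ne_zero hc' hv) hv).2 ⟨c, rfl⟩]
    rw [← MvPolynomial.sum_homogeneousComponent f, map_sum] at h1
    simp only [Set.mem_ofPred_eq, Polynomial.IsRoot, hq, Polynomial.eval_finsetSum,
      Polynomial.eval_monomial]
    rw [← h1]
    refine Finset.sum_congr rfl fun m _ => ?_
    rw [aeval_smul_of_isHomogeneous (MvPolynomial.homogeneousComponent_isHomogeneous m f),
      mul_comm]
  by_cases hn : n < f.totalDegree + 1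
  · have := congrArg (Polynomial.coeff · n) hq0
    simpa [hq, Polynomial.finsetSum_coeff, Polynomial.coeff_monomial, hn] using this
  · rw [MvPolynomial.homogeneousComponent_eq_zero _ _ (by omega), map_zero]

theorem vanishingIdeal_spans_isPrime {ι : Type*} [Fintype ι] [Nonempty ι]
    (X : ι → ProjectiveVariety k N) : (vanishingIdeal (spans X)).IsPrime := by
  have key : ∀ f, f ∉ vanishingIdeal (spans X) → ∃ c : ι → Fin (N + 1) → k,
      (∀ i, c i ∈ (X i).cone) ∧ ∃ j, MvPolynomial.aeval (∑ i, c i + 0)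
        (f * MvPolynomial.X j) ≠ 0 := by
    intro f hf
    rw [mem_vanishingIdeal_spans_iff] at hf
    push Not at hf
    obtain ⟨c, hc, h0, h⟩ := hf
    obtain ⟨j, hj⟩ := Function.ne_iff.1 h0
    exact ⟨c, hc, j, by simpa using ⟨h, by simpa using hj⟩⟩
  refine ⟨fun h => ?_, fun {f g} hfg => ?_⟩
  · obtain ⟨c, hc, h0⟩ := exists_sum_ne_zero X
    have h1 : (1 : MvPolynomial (Fin (N + 1)) k) ∈ vanishingIdeal (spans X) := by
      rw [h]; trivial
    rw [mem_vanishingIdeal_spans_iff] at h1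
    simpa using h1 c hc h0
  · by_contra! hcon
    obtain ⟨a, ha, i, hi⟩ := key f hcon.1
    obtain ⟨b, hb, j, hj⟩ := key g hcon.2
    obtain ⟨c, hc, h1, h2⟩ := exists_common_sum Finset.univ X _ _ a b ha hb 0 0 hi hj
    rw [add_zero, map_mul] at h1 h2
    rw [mem_vanishingIdeal_spans_iff] at hfg
    have h0 : ∑ i, c i ≠ 0 := fun h => by simp [h] at h1
    have := hfg c hc h0
    rw [map_mul] at this
    rcases mul_eq_zero.1 this with h | h
    · exact left_ne_zero_of_mul h1 h
    · exact left_ne_zero_of_mul h2 h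

end Helpers

section RuledJoin

/-! ### The ruled join -/

/-- The homogeneous coordinate ring of the ruled join `J(X, Y)`: the tensor product of the
homogeneous coordinate rings of `X` and `Y`. -/
abbrev RuledJoinRing (X Y : ProjectiveVariety k N) : Type _ := X.coordRing ⊗[k] Y.coordRing

/-- Evaluation at a point of the cone. -/
def evalAt (X : ProjectiveVariety k N) (v : X.cone) : X.coordRing →ₐ[k] k :=
  Ideal.Quotient.liftₐ X.ideal (MvPolynomial.aeval (v : Fin (N + 1) → k)) fun f hf => v.2 f hf

@[simp]
theorem evalAt_toCoordRing (X : ProjectiveVariety k N) (v : X.cone) (f : MvPolynomial (Fin (N + 1)) k) :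
    X.evalAt v (X.toCoordRing f) = MvPolynomial.aeval v.1 f := rfl

/-- Partial evaluation of the coordinate ring of the ruled join, in the first variables. -/
def evalLeft (X Y : ProjectiveVariety k N) (v : X.cone) : RuledJoinRing X Y →ₐ[k] Y.coordRing :=
  Algebra.TensorProduct.lift ((Algebra.ofId k Y.coordRing).comp (X.evalAt v)) (AlgHom.id k _)
    fun _ _ => Commute.all _ _

/-- Partial evaluation of the coordinate ring of the ruled join, in the second variables. -/
def evalRight (X Y : ProjectiveVariety k N) (w : Y.cone) : RuledJoinRing X Y →ₐ[k] X.coordRing :=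
  Algebra.TensorProduct.lift (AlgHom.id k _) ((Algebra.ofId k X.coordRing).comp (Y.evalAt w))
    fun _ _ => Commute.all _ _

theorem eval_comm (X Y : ProjectiveVariety k N) (v : X.cone) (w : Y.cone)
    (t : RuledJoinRing X Y) :
    Y.evalAt w (evalLeft X Y v t) = X.evalAt v (evalRight X Y w t) := by
  rw [← AlgHom.comp_apply, ← AlgHom.comp_apply]
  congr 1
  apply Algebra.TensorProduct.ext'
  intro a b
  simp [evalLeft, evalRight, Algebra.ofId_apply]

end RuledJoin

section Joins

variable [IsAlgClosed k]

/-- The closure in `ℙ^N` of the union of all linear subspaces spanned by points `p i ∈ X i`. -/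
def joinOfFamily {ι : Type*} [Fintype ι] [Nonempty ι] (X : ι → ProjectiveVariety k N) :
    ProjectiveVariety k N where
  ideal := vanishingIdeal (spans X)
  isHomogeneous := vanishingIdeal_isHomogeneous _
  isPrime := vanishingIdeal_spans_isPrime X
  exists_X_notMem := by
    obtain ⟨c, hc, h0⟩ := exists_sum_ne_zero X
    obtain ⟨j, hj⟩ := Function.ne_iff.1 h0
    refine ⟨j, fun h => hj ?_⟩
    rw [mem_vanishingIdeal_spans_iff] at h
    simpa using h c hc h0

/-- The embedded join `XY`: the closure of the union of the lines joining a point of `X` to a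
point of `Y`. -/
def embeddedJoin (X Y : ProjectiveVariety k N) : ProjectiveVariety k N := joinOfFamily ![X, Y]

/-- The `r`-secant variety `σ_r(X)`: the closure of the union of the linear subspaces spanned by
`r` points of `X`. -/
def secantVariety (X : ProjectiveVariety k N) (r : ℕ) [NeZero r] : ProjectiveVariety k N :=
  joinOfFamily fun _ : Fin r => X

theorem eq_zero_of_evalAt (X : ProjectiveVariety k N) (a : X.coordRing)
    (h : ∀ v, X.evalAt v a = 0) : a = 0 := by
  obtain ⟨f, rfl⟩ := toCoordRing_surjective _ a
  rw [toCoordRing_eq_zero_iff, mem_ideal_iff]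
  exact fun v hv => h ⟨v, hv⟩

theorem eq_zero_of_evalLeft (X Y : ProjectiveVariety k N) (t : RuledJoinRing X Y)
    (h : ∀ v, evalLeft X Y v t = 0) : t = 0 := by
  classical
  obtain ⟨c, rfl⟩ := TensorProduct.eq_repr_basis_right (Module.Basis.ofVectorSpace k Y.coordRing) t
  suffices c = 0 by simp [this]
  ext i
  refine X.eq_zero_of_evalAt _ fun v => ?_
  have hv := h v
  rw [Finsupp.sum, map_sum] at hv
  have e : ∀ j, evalLeft X Y v (c j ⊗ₜ Module.Basis.ofVectorSpace k Y.coordRing j) =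
      X.evalAt v (c j) • Module.Basis.ofVectorSpace k Y.coordRing j := fun j => by
    simp [evalLeft, Algebra.ofId_apply, Algebra.smul_def]
  simp only [e] at hv
  by_cases hi : i ∈ c.support
  · exact linearIndependent_iff'.1 (Module.Basis.ofVectorSpace k Y.coordRing).linearIndependent
      _ _ hv i hi
  · rw [Finsupp.notMem_support_iff.1 hi, map_zero]

theorem eq_zero_of_eval (X Y : ProjectiveVariety k N) (t : RuledJoinRing X Y)
    (h : ∀ v w, Y.evalAt w (evalLeft X Y v t) = 0) : t = 0 :=
  eq_zero_of_evalLeft X Y t fun v => Y.eq_zero_of_evalAt _ (h v)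

/-- The ruled join is integral. -/
instance (X Y : ProjectiveVariety k N) : IsDomain (RuledJoinRing X Y) := by
  have hnt : Nontrivial (RuledJoinRing X Y) := by
    obtain ⟨v, hv, _⟩ := X.exists_cone_ne_zero
    exact (evalLeft X Y ⟨v, hv⟩).toRingHom.domain_nontrivial
  have : NoZeroDivisors (RuledJoinRing X Y) := by
    refine ⟨fun {s t} hst => ?_⟩
    by_contra! hcon
    have h1 : ∃ v w, Y.evalAt w (evalLeft X Y v s) ≠ 0 := by
      by_contra! h; exact hcon.1 (eq_zero_of_eval X Y s h)
    have h2 : ∃ v w, Y.evalAt w (evalLeft X Y v t) ≠ 0 := by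
      by_contra! h; exact hcon.2 (eq_zero_of_eval X Y t h)
    obtain ⟨v, w, h1⟩ := h1
    obtain ⟨v', w', h2⟩ := h2
    rw [eval_comm] at h1 h2
    have h3 : ∃ u, X.evalAt u (evalRight X Y w s * evalRight X Y w' t) ≠ 0 := by
      by_contra! h
      have h' : evalRight X Y w s * evalRight X Y w' t = 0 := X.eq_zero_of_evalAt _ h
      rcases mul_eq_zero.1 h' with h | h
      · exact h1 (by rw [h, map_zero])
      · exact h2 (by rw [h, map_zero])
    obtain ⟨u, hu⟩ := h3
    rw [map_mul, ← eval_comm, ← eval_comm] at hu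
    have h4 : evalLeft X Y u s * evalLeft X Y u t = 0 := by rw [← map_mul, hst, map_zero]
    rcases mul_eq_zero.1 h4 with h | h
    · exact left_ne_zero_of_mul hu (by rw [h, map_zero])
    · exact right_ne_zero_of_mul hu (by rw [h, map_zero])
  exact NoZeroDivisors.to_isDomain _

/-- The elements of (total) degree `n` of the homogeneous coordinate ring of the ruled join. -/
def ruledJoinPiece (X Y : ProjectiveVariety k N) (n : ℕ) : Submodule k (RuledJoinRing X Y) :=
  Submodule.span k {t | ∃ i j, i + j = n ∧ ∃ a ∈ X.piece i, ∃ b ∈ Y.piece j, t = a ⊗ₜ b}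

instance (X Y : ProjectiveVariety k N) : SetLike.GradedMonoid (ruledJoinPiece X Y) where
  one_mem := Submodule.subset_span
    ⟨0, 0, rfl, 1, SetLike.GradedOne.one_mem, 1, SetLike.GradedOne.one_mem, rfl⟩
  mul_mem := by
    intro m n s t hs ht
    have hst : s * t ∈ ruledJoinPiece X Y m * ruledJoinPiece X Y n := Submodule.mul_mem_mul hs ht
    rw [ruledJoinPiece, ruledJoinPiece, Submodule.span_mul_span] at hst
    refine Submodule.span_mono ?_ hst
    rintro _ ⟨_, ⟨i, j, rfl, a, ha, b, hb, rfl⟩, _, ⟨i', j', rfl, a', ha', b', hb', rfl⟩, rfl⟩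
    exact ⟨i + i', j + j', by omega, a * a', SetLike.GradedMul.mul_mem ha ha', b * b',
      SetLike.GradedMul.mul_mem hb hb', by simp⟩

/-- The ring homomorphism `f ↦ f(x_0 - y_0, …, x_N - y_N)`. -/
def substDiff (X Y : ProjectiveVariety k N) :
    MvPolynomial (Fin (N + 1)) k →ₐ[k] RuledJoinRing X Y :=
  MvPolynomial.aeval fun i => X.coord i ⊗ₜ[k] 1 - 1 ⊗ₜ[k] Y.coord i

theorem eval_substDiff (X Y : ProjectiveVariety k N) (v : X.cone) (w : Y.cone)
    (f : MvPolynomial (Fin (N + 1)) k) : Y.evalAt w (evalLeft X Y v (substDiff X Y f)) =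
      MvPolynomial.aeval (v.1 - w.1) f := by
  rw [← AlgHom.comp_apply, ← AlgHom.comp_apply]
  congr 1
  ext i
  simp [substDiff, evalLeft, coord, Algebra.ofId_apply]

theorem substDiff_eq_zero_iff (X Y : ProjectiveVariety k N) (f : MvPolynomial (Fin (N + 1)) k) :
    substDiff X Y f = 0 ↔ f ∈ (embeddedJoin X Y).ideal := by
  have hneg : ∀ w ∈ Y.cone, -w ∈ Y.cone := fun w hw => by
    simpa using Y.smul_mem_cone (-1) hw
  constructor
  · intro h
    refine (mem_vanishingIdeal_spans_iff _ f).2 fun c hc _ => ?_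
    have := eval_substDiff X Y ⟨c 0, hc 0⟩ ⟨-c 1, hneg _ (hc 1)⟩ f
    rw [h, map_zero, map_zero] at this
    rw [Fin.sum_univ_two, this]
    simp
  · intro h
    refine eq_zero_of_eval X Y _ fun v w => ?_
    rw [eval_substDiff]
    by_cases h0 : v.1 - w.1 = 0
    · obtain ⟨u, hu, _⟩ := (embeddedJoin X Y).exists_cone_ne_zero
      rw [h0, ← zero_smul k u]
      exact (embeddedJoin X Y).smul_mem_cone 0 hu f h
    · have := (mem_vanishingIdeal_spans_iff _ f).1 h ![v.1, -w.1]
      simp only [Fin.sum_univ_two, Fin.forall_fin_two] at this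
      simpa [sub_eq_add_neg] using this ⟨v.2, hneg _ w.2⟩ (by simpa [sub_eq_add_neg] using h0)

/-- The homomorphism `f ↦ f(x_0 - y_0, …, x_N - y_N)` of homogeneous coordinate rings that gives
the rational map `J(X, Y) ⇢ XY`, `[x : y] ↦ [x_0 - y_0 : … : x_N - y_N]`. -/
def additionMap (X Y : ProjectiveVariety k N) :
    (embeddedJoin X Y).coordRing →ₐ[k] RuledJoinRing X Y :=
  Ideal.Quotient.liftₐ (embeddedJoin X Y).ideal (substDiff X Y)
    fun f hf => (substDiff_eq_zero_iff X Y f).2 hf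

theorem additionMap_injective (X Y : ProjectiveVariety k N) :
    Function.Injective (additionMap X Y) := by
  rw [injective_iff_map_eq_zero]
  intro a ha
  obtain ⟨f, rfl⟩ := toCoordRing_surjective _ a
  rw [toCoordRing_eq_zero_iff, ← substDiff_eq_zero_iff]
  exact ha

theorem additionMap_mem (X Y : ProjectiveVariety k N) (n : ℕ)
    (a : (embeddedJoin X Y).coordRing) (ha : a ∈ (embeddedJoin X Y).piece n) :
    additionMap X Y a ∈ ruledJoinPiece X Y n := by
  obtain ⟨f, hf, rfl⟩ := ha
  change substDiff X Y f ∈ _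
  have h1 : ∀ i, X.coord i ⊗ₜ[k] 1 - 1 ⊗ₜ[k] Y.coord i ∈ ruledJoinPiece X Y 1 := fun i =>
    sub_mem
      (Submodule.subset_span ⟨1, 0, rfl, _, ⟨_, MvPolynomial.isHomogeneous_X _ i, rfl⟩, 1,
        SetLike.GradedOne.one_mem, rfl⟩)
      (Submodule.subset_span ⟨0, 1, rfl, 1, SetLike.GradedOne.one_mem, _,
        ⟨_, MvPolynomial.isHomogeneous_X _ i, rfl⟩, rfl⟩)
  rw [substDiff, MvPolynomial.aeval_def, MvPolynomial.eval₂_eq]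
  refine sum_mem fun d hd => ?_
  rw [← Algebra.smul_def]
  refine Submodule.smul_mem _ _ ?_
  have hdn : ∑ i ∈ d.support, d i • 1 = n := by
    have := hf (MvPolynomial.mem_support_iff.1 hd)
    simpa [Finsupp.weight_apply, Finsupp.sum] using this
  rw [← hdn]
  exact SetLike.prod_pow_mem_graded (ruledJoinPiece X Y) _ _ _ fun i _ => h1 i

/-- `deg (J / XY)`: the degree of the dominant rational map `J(X, Y) ⇢ XY`,
`[x : y] ↦ [x - y]`, from the ruled join to the embedded join. -/
def joinDegree (X Y : ProjectiveVariety k N) : ℕ :=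
  GradedDomain.rationalMapDegree (embeddedJoin X Y).piece (ruledJoinPiece X Y) (additionMap X Y)
    (additionMap_injective X Y) (additionMap_mem X Y)

end Joins

end ProjectiveVariety

end

noncomputable section

/-! Let `C` be the affine cone over `X`. The maps `C³ → C × cone(σ₂) → cone(σ₃)`, `(p, q, r) ↦ (p,
-(q + r)) ↦ p + q + r`, are dominant, and the second one is the map of the theorem on affine cones.
It is enough to show that the composite has degree 6 and the first map degree 2; then 6 / 2 = 3.

Both degrees are orders of groups permuting the three factors. If two triples of vectors of `C`,
each on three distinct lines, have the same sum, at most six points of `X` are involved. These are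
linearly independent because `𝒪(1)` is 5-very ample and all its sections are linear forms
(`linearIndepOn_rep`), so the triples agree up to order (`exists_perm_of_sum_eq`). General fibres of
the composite thus lie in orbits of `S₃`, and those of the first map, where `p` is also known, in
orbits of the stabilizer of a factor.

In characteristic zero, fibres contained in orbits of a finite group `G` acting faithfully by
automorphisms over the base force the degree to be `|G|` (`finrank_eq_card_of_fibres`). By Artin's
theorem this reduces to showing that an invariant function, being determined by the values of
functions from the base, lies in the smaller field (`mem_range_of_forall_eq`). Finally,
`rationalMapDegree_eq_finrank` passes from fraction fields of cones to the degree-zero function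
fields. -/

/-! ### Functions constant on fibres, and quotients by finite groups -/

/-- Nullstellensatz: in a Jacobson ring the radical of `I` is an intersection of maximal ideals, and
a residue field of finite type over `k` is `k` itself. -/
theorem exists_algHom_of_notMem_radical {k R : Type*} [Field k] [IsAlgClosed k] [CommRing R]
    [Algebra k R] [Algebra.FiniteType k R] (I : Ideal R) {u : R} (hu : u ∉ I.radical) :
    ∃ χ : R →ₐ[k] k, (∀ a ∈ I, χ a = 0) ∧ χ u ≠ 0 := by
  have hR : IsJacobsonRing R := isJacobsonRing_of_finiteType (A := k)
  rw [← hR.out I.radical_isRadical, Ideal.jacobson, Submodule.mem_sInf] at hu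
  push Not at hu
  obtain ⟨m, ⟨hIm, hm⟩, hum⟩ := hu
  let _ : Field (R ⧸ m) := Ideal.Quotient.field m
  have : Module.Finite k (R ⧸ m) := finite_of_finite_type_of_isJacobsonRing k (R ⧸ m)
  have hb : Function.Bijective (algebraMap k (R ⧸ m)) :=
    IsAlgClosed.algebraMap_bijective_of_isIntegral
  let e := AlgEquiv.ofBijective (Algebra.ofId k (R ⧸ m)) hb
  refine ⟨e.symm.toAlgHom.comp (Ideal.Quotient.mkₐ k m), fun a ha => ?_, fun h => hum ?_⟩
  · have : Ideal.Quotient.mk m a = 0 := Ideal.Quotient.eq_zero_iff_mem.2 (hIm (I.le_radical ha))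
    simp [this]
  · simpa [Ideal.Quotient.eq_zero_iff_mem] using h

/-- Expand by the binomial theorem and apply `id ⊗ φ`: only the term `bⁿ ⊗ 1` survives, and it gives
a nonzero multiple of `bⁿ`. -/
theorem tmul_sub_tmul_pow_ne_zero {E F : Type*} [Field E] [Field F] [Algebra E F] {b : F} {n : ℕ}
    (φ : F →ₗ[E] E) (h1 : φ 1 ≠ 0) (hφ : ∀ j < n, φ (b ^ (j + 1)) = 0) (hb : b ≠ 0) :
    (b ⊗ₜ[E] (1 : F) - 1 ⊗ₜ[E] b) ^ n ≠ 0 := by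
  intro h
  let T : F ⊗[E] F →ₗ[E] F := (TensorProduct.rid E F).toLinearMap ∘ₗ φ.lTensor F
  have hT := congrArg T h
  rw [sub_eq_add_neg, (Commute.all _ _).add_pow, map_sum, map_zero,
    Finset.sum_eq_single n] at hT
  · simp [T, h1, hb] at hT
  · intro m hm hmn
    obtain ⟨j, hj⟩ : ∃ j, n - m = j + 1 :=
      ⟨n - m - 1, by have := Finset.mem_range.1 hm; omega⟩
    have hj' : φ (b ^ (n - m)) = 0 := by rw [hj]; exact hφ j (by omega)
    rw [← nsmul_eq_mul', map_nsmul, neg_pow, Algebra.TensorProduct.tmul_pow,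
      Algebra.TensorProduct.tmul_pow]
    rcases neg_one_pow_eq_or (F ⊗[E] F) (n - m) with h | h <;> simp [T, h, hj']
  · simp

/-- A finite extension `M` of `E` in characteristic zero is separable, so `M ⊗ M` is reduced; by
flatness it embeds in `F ⊗ F`. -/
theorem tmul_sub_tmul_eq_zero_of_isNilpotent {E M F : Type*} [Field E] [Field M] [Field F]
    [Algebra E M] [Algebra E F] [FiniteDimensional E M] [CharZero E] (f : M →ₐ[E] F) (b : M)
    (h : IsNilpotent (f b ⊗ₜ[E] (1 : F) - 1 ⊗ₜ[E] f b)) :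
    f b ⊗ₜ[E] (1 : F) - 1 ⊗ₜ[E] f b = 0 := by
  have hunr : Algebra.FormallyUnramified E M := Algebra.FormallyUnramified.of_isSeparable E M
  have hred : IsReduced (M ⊗[E] M) := Algebra.FormallyUnramified.isReduced_of_field M (M ⊗[E] M)
  have hinj : Function.Injective (Algebra.TensorProduct.map f f) :=
    TensorProduct.map_injective_of_flat_flat _ _ f.injective f.injective
  have hb : Algebra.TensorProduct.map f f (b ⊗ₜ[E] 1 - 1 ⊗ₜ[E] b) =
      f b ⊗ₜ[E] (1 : F) - 1 ⊗ₜ[E] f b := by simp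
  rw [← hb, IsNilpotent.map_iff hinj] at h
  rw [← hb, h.eq_zero, map_zero]

theorem not_isNilpotent_tmul_sub_tmul {E F : Type*} [Field E] [Field F] [Algebra E F] [CharZero E]
    {b : F} (hb : b ∉ (algebraMap E F).range) :
    ¬ IsNilpotent (b ⊗ₜ[E] (1 : F) - 1 ⊗ₜ[E] b) := by
  rintro ⟨n, hn⟩
  have hb0 : b ≠ 0 := fun h => hb ⟨0, by simp [h]⟩
  by_cases hal : IsAlgebraic E b
  · have hfin : FiniteDimensional E (IntermediateField.adjoin E {b}) :=
      IntermediateField.adjoin.finiteDimensional hal.isIntegral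
    have h0 := tmul_sub_tmul_eq_zero_of_isNilpotent (E := E)
      (IntermediateField.adjoin E {b}).val (IntermediateField.AdjoinSimple.gen E b)
      ⟨n, by simpa using hn⟩
    -- As `b ∉ E`, the vector `1` is not a multiple of `b`, so some functional kills `b` but not
    -- `1`. Since the nilpotent difference is already zero, exponent 1 suffices for the
    -- contradiction.
    obtain ⟨φ, h1, hφ⟩ := Submodule.exists_dual_map_eq_bot_of_notMem (x := (1 : F))
      (p := Submodule.span E {b}) (fun h => by
        obtain ⟨c, hc⟩ := Submodule.mem_span_singleton.1 h
        refine hb ⟨c⁻¹, ?_⟩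
        rw [map_inv₀]
        exact inv_eq_of_mul_eq_one_right (by rwa [← Algebra.smul_def])) inferInstance
    refine tmul_sub_tmul_pow_ne_zero (n := 1) φ h1 (fun j hj => ?_) hb0 ?_
    · have : φ (b ^ (j + 1)) ∈ (Submodule.span E {b}).map φ :=
        ⟨b ^ (j + 1), by simp [Nat.lt_one_iff.1 hj], rfl⟩
      simpa [hφ] using this
    · simpa using h0
  · let p : Submodule E F :=
      ((Ideal.span {(Polynomial.X : Polynomial E)}).restrictScalars E).map
        (Polynomial.aeval b).toLinearMap
    obtain ⟨φ, h1, hφ⟩ := Submodule.exists_dual_map_eq_bot_of_notMem (x := (1 : F)) (p := p)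
      (by
        rintro ⟨q, hq, h⟩
        refine hal ⟨1 - q, fun h' => ?_, by simpa [sub_eq_zero] using h.symm⟩
        have h0 := Polynomial.X_dvd_iff.1 (Ideal.mem_span_singleton.1 hq)
        simpa [h0] using congrArg (Polynomial.coeff · 0) h') inferInstance
    refine tmul_sub_tmul_pow_ne_zero φ h1 (fun j _ => ?_) hb0 hn
    have : φ (b ^ (j + 1)) ∈ p.map φ :=
      ⟨b ^ (j + 1), ⟨Polynomial.X ^ (j + 1), Ideal.mem_span_singleton.2 (dvd_pow_self _ (by simp)),
        by simp⟩, rfl⟩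
    simpa [hφ] using this

/-- A function `b` on an integral affine variety over an algebraically closed field of
characteristic zero lies in a subfield `E` of an extension `F` of its function field as soon as
its values are determined, on some nonempty open set, by those of the functions in a subring of
`E`. -/
theorem mem_range_of_forall_eq {k A B E F : Type*} [Field k] [IsAlgClosed k] [CharZero k]
    [CommRing A] [Algebra k A] [CommRing B] [Algebra k B] [Algebra.FiniteType k B] [Field E]
    [Field F] [Algebra k E] [Algebra k F] [Algebra E F] [IsScalarTower k E F]
    (β : B →ₐ[k] F) (hβ : Function.Injective β) (φ : A →ₐ[k] B)
    (hφ : ∀ a, β (φ a) ∈ (algebraMap E F).range) {g : B} (hg : g ≠ 0) (b : B)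
    (h : ∀ χ ψ : B →ₐ[k] k, (∀ a, χ (φ a) = ψ (φ a)) → χ g ≠ 0 → ψ g ≠ 0 → χ b = ψ b) :
    β b ∈ (algebraMap E F).range := by
  by_contra hb
  have : CharZero E := charZero_of_injective_algebraMap (algebraMap k E).injective
  -- The `k`-points of `B ⊗ B` that kill the kernel of `Φ` are pairs of points of `Spec B` with the
  -- same image in `Spec A`. The factor `g ⊗ g` of `u` puts both points in `D(g)`, and the other
  -- factor makes `b` differ at them.
  let Φ : B ⊗[k] B →ₐ[k] F ⊗[E] F := Algebra.TensorProduct.lift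
    ((Algebra.TensorProduct.includeLeft (R := E) (S := k) (A := F) (B := F)).comp β)
    (((Algebra.TensorProduct.includeRight (R := E) (A := F) (B := F)).restrictScalars k).comp β)
    fun _ _ => Commute.all _ _
  let u : B ⊗[k] B := g ⊗ₜ g * (b ⊗ₜ 1 - 1 ⊗ₜ b)
  have hu : u ∉ (RingHom.ker Φ).radical := by
    rintro ⟨n, hn⟩
    have hn' : Φ u ^ n = 0 := by rw [← map_pow]; exact hn
    refine not_isNilpotent_tmul_sub_tmul hb ⟨n, ?_⟩
    have hΦ : Φ u = (β g ⊗ₜ β g) * (β b ⊗ₜ 1 - 1 ⊗ₜ β b) := by simp [Φ, u]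
    have hg' : β g ≠ 0 := by simpa using hβ.ne hg
    have hinv : ((β g)⁻¹ ⊗ₜ[E] (β g)⁻¹) * (β g ⊗ₜ[E] β g) = 1 := by
      simp [hg', Algebra.TensorProduct.one_def]
    rw [hΦ] at hn'
    calc (β b ⊗ₜ[E] (1 : F) - 1 ⊗ₜ[E] β b) ^ n
        = ((β g)⁻¹ ⊗ₜ[E] (β g)⁻¹) ^ n * ((β g ⊗ₜ β g) * (β b ⊗ₜ 1 - 1 ⊗ₜ β b)) ^ n := by
          rw [← mul_pow, ← mul_assoc, hinv, one_mul]
      _ = 0 := by rw [hn', mul_zero]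
  have : Algebra.FiniteType k (B ⊗[k] B) := Algebra.FiniteType.trans (S := B) inferInstance
    inferInstance
  obtain ⟨χ, hχ, hχu⟩ := exists_algHom_of_notMem_radical (k := k) (RingHom.ker Φ) hu
  let χ₁ : B →ₐ[k] k := χ.comp Algebra.TensorProduct.includeLeft
  let χ₂ : B →ₐ[k] k := χ.comp Algebra.TensorProduct.includeRight
  have hg12 : χ (g ⊗ₜ g) = χ₁ g * χ₂ g := by
    simp [χ₁, χ₂, ← map_mul]
  have hu12 : χ u = χ₁ g * χ₂ g * (χ₁ b - χ₂ b) := by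
    simp only [u, map_mul, hg12, map_sub]
    rfl
  rw [hu12] at hχu
  refine right_ne_zero_of_mul hχu (sub_eq_zero.2 (h χ₁ χ₂ (fun a => ?_)
    (left_ne_zero_of_mul (left_ne_zero_of_mul hχu))
    (right_ne_zero_of_mul (left_ne_zero_of_mul hχu))))
  refine sub_eq_zero.1 ?_
  change χ (φ a ⊗ₜ 1) - χ (1 ⊗ₜ φ a) = 0
  rw [← map_sub]
  refine hχ _ ?_
  -- Since `φ a` comes from `E`, it moves across the tensor product over `E`; so `φ a ⊗ 1 - 1 ⊗ φ a`
  -- lies in the kernel.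
  obtain ⟨e, he⟩ := hφ a
  rw [RingHom.mem_ker]
  simp [Φ, ← he, Algebra.TensorProduct.tmul_one_eq_one_tmul]

/-- If a finite group `G` acts faithfully on an integral affine variety `Spec B` over an
algebraically closed field of characteristic zero, and the fibres of `Spec B → Spec A` over a
nonempty open set are contained in orbits of `G`, then the degree of `Spec B → Spec A` is `|G|`. -/
theorem finrank_eq_card_of_fibres {k A B E F : Type*} [Field k] [IsAlgClosed k] [CharZero k]
    [CommRing A] [IsDomain A] [Algebra k A] [CommRing B] [IsDomain B] [Algebra k B]
    [Algebra.FiniteType k B] [Field E] [Field F] [Algebra A E] [IsFractionRing A E] [Algebra B F]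
    [IsFractionRing B F] [Algebra k E] [Algebra k F] [Algebra E F] [IsScalarTower k E F]
    [IsScalarTower k B F] (φ : A →ₐ[k] B)
    (hEF : ∀ a, algebraMap E F (algebraMap A E a) = algebraMap B F (φ a))
    (G : Subgroup (B ≃ₐ[k] B)) [Finite G] (hG : ∀ σ ∈ G, ∀ a, σ (φ a) = φ a) {g : B} (hg : g ≠ 0)
    (h : ∀ χ ψ : B →ₐ[k] k, (∀ a, χ (φ a) = ψ (φ a)) → χ g ≠ 0 → ψ g ≠ 0 →
      ∃ σ ∈ G, ∀ b, ψ b = χ (σ b)) :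
    Module.finrank E F = Nat.card G := by
  classical
  have hB : Function.Injective (algebraMap B F) := IsFractionRing.injective B F
  let _ : MulSemiringAction G F := IsFractionRing.mulSemiringAction G B F
  have hsm : ∀ (σ : G) (b : B), σ • algebraMap B F b = algebraMap B F ((σ : B ≃ₐ[k] B) b) :=
    fun σ b => by rw [← algebraMap.coe_smul']; rfl
  have : FaithfulSMul G F := IsFractionRing.faithfulSMul G B F
  have hfix : ∀ b : B, (∀ σ ∈ G, σ b = b) → algebraMap B F b ∈ (algebraMap E F).range := by
    intro b hb
    refine mem_range_of_forall_eq (IsScalarTower.toAlgHom k B F) hB φ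
      (fun a => ⟨_, hEF a⟩) hg b fun χ ψ h1 h2 h3 => ?_
    obtain ⟨σ, hσ, e⟩ := h χ ψ h1 h2 h3
    rw [e, hb σ hσ]
  have h1 : ∀ x : E, algebraMap E F x ∈ FixedPoints.subfield G F := by
    intro x σ
    obtain ⟨a, c, _, rfl⟩ := IsFractionRing.div_surjective A x
    rw [map_div₀, hEF, hEF, smul_div₀', hsm, hsm, hG σ σ.2, hG σ σ.2]
  have h2 : ∀ z ∈ FixedPoints.subfield G F, z ∈ (algebraMap E F).range := by
    intro z hz
    obtain ⟨b, d, hd, rfl⟩ := IsFractionRing.div_surjective B z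
    have hd0 : d ≠ 0 := nonZeroDivisors.ne_zero hd
    have := Fintype.ofFinite G
    -- Replace the denominator by its norm, which is invariant. As the fraction is invariant too, so
    -- is the new numerator, and `hfix` applies to both.
    let n : B := ∏ σ : G, σ • d
    let m : B := b * ∏ σ ∈ Finset.univ.erase (1 : G), σ • d
    have hn : n = d * ∏ σ ∈ Finset.univ.erase (1 : G), σ • d := by
      simpa using (Finset.mul_prod_erase Finset.univ (fun σ : G => σ • d)
        (Finset.mem_univ 1)).symm
    have hn0 : n ≠ 0 := Finset.prod_ne_zero_iff.2 fun σ _ => by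
      rwa [smul_ne_zero_iff_ne]
    have hzn : algebraMap B F b / algebraMap B F d * algebraMap B F n = algebraMap B F m := by
      have : algebraMap B F d ≠ 0 := by simpa using hB.ne hd0
      simp only [hn, m, map_mul]
      field_simp
    have hnG : ∀ σ ∈ G, σ n = n := fun σ hσ => Finset.smul_prod_perm d (⟨σ, hσ⟩ : G)
    have hmG : ∀ σ ∈ G, σ m = m := fun σ hσ => hB (by
      rw [← hsm ⟨σ, hσ⟩, ← hzn, smul_mul', hz ⟨σ, hσ⟩, hsm, hnG σ hσ])
    have : algebraMap B F b / algebraMap B F d = algebraMap B F m / algebraMap B F n := by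
      rw [← hzn, mul_div_cancel_right₀]
      simpa using hB.ne hn0
    rw [this]
    obtain ⟨x, hx⟩ := hfix m hmG
    obtain ⟨y, hy⟩ := hfix n hnG
    exact ⟨x / y, by rw [map_div₀, hx, hy]⟩
  -- With `E` identified with the fixed field, the degree is given by Artin's theorem.
  let i : E ≃+* FixedPoints.subfield G F := RingEquiv.ofBijective
    ((algebraMap E F).codRestrict (FixedPoints.subfield G F).toSubring h1)
    ⟨fun x y hxy => (algebraMap E F).injective (congrArg Subtype.val hxy), fun z => by
      obtain ⟨x, hx⟩ := h2 z z.2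
      exact ⟨x, Subtype.ext hx⟩⟩
  have := Fintype.ofFinite G
  rw [Algebra.finrank_eq_of_equiv_equiv i (RingEquiv.refl F) (by ext; rfl),
    FixedPoints.finrank_eq_card, Nat.card_eq_fintype_card]

-- Function fields of projective varieties and of their cones

universe v

namespace GradedDomain

/-- A `K`-basis of `L` is also an `E`-basis of `F`: `hind` gives independence and `hspan` gives
generation. -/
theorem finrank_subfield_eq {E : Type*} {F : Type v} [Field E] [Field F] [Algebra E F] (K : Subfield E)
    (L : Subfield F) [Algebra K L]
    (hKL : ∀ x : K, (algebraMap K L x : F) = algebraMap E F x)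
    (hind : ∀ (ι : Type v) (b : ι → L), LinearIndependent K b →
      LinearIndependent E fun i => (b i : F))
    (hspan : Submodule.span E (L : Set F) = ⊤) : Module.finrank K L = Module.finrank E F := by
  obtain ⟨ι, ⟨b⟩⟩ : ∃ ι : Type v, Nonempty (Module.Basis ι K L) :=
    ⟨_, ⟨Module.Basis.ofVectorSpace K L⟩⟩
  have hsp : ⊤ ≤ Submodule.span E (Set.range fun i => (b i : F)) := by
    rw [← hspan, Submodule.span_le]
    intro x hx
    rw [show x = ((⟨x, hx⟩ : L) : F) from rfl, ← b.linearCombination_repr ⟨x, hx⟩,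
      Finsupp.linearCombination_apply, Finsupp.sum, AddSubmonoidClass.coe_finsetSum]
    refine Submodule.sum_mem _ fun i _ => ?_
    rw [Algebra.smul_def, MulMemClass.coe_mul, hKL, ← Algebra.smul_def]
    exact Submodule.smul_mem _ _ (Submodule.subset_span ⟨i, rfl⟩)
  rw [Module.finrank_eq_nat_card_basis b,
    Module.finrank_eq_nat_card_basis (Module.Basis.mk (hind ι b b.linearIndependent) hsp)]

variable {k R R' : Type*} [Field k] [CommRing R] [IsDomain R] [Algebra k R]
  [CommRing R'] [IsDomain R'] [Algebra k R']
  (𝒜 : ℕ → Submodule k R) [SetLike.GradedMonoid 𝒜]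
  (ℬ : ℕ → Submodule k R') [SetLike.GradedMonoid ℬ]

/-- What matters is that all numerators have one common degree: a linear relation between them can
then be split into its graded components. -/
theorem exists_common_denominator {ι : Type*} (s : Finset ι) (b : ι → functionField ℬ) :
    ∃ m, ∃ d ≠ 0, ∃ a : ι → R', (∀ i ∈ s, a i ∈ ℬ m) ∧
      ∀ i ∈ s, (b i : FractionRing R') * algebraMap R' _ d = algebraMap R' _ (a i) := by
  classical
  choose n a ha d hd hd0 e using fun i => (b i).2
  refine ⟨∑ i ∈ s, n i, ∏ i ∈ s, d i, Finset.prod_ne_zero_iff.2 fun i _ => hd0 i,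
    fun i => a i * ∏ j ∈ s.erase i, d j, fun i hi => ?_, fun i hi => ?_⟩
  · rw [← Finset.add_sum_erase _ _ hi]
    exact SetLike.GradedMul.mul_mem (ha i) (SetLike.prod_mem_graded ℬ _ _ fun j _ => hd j)
  · have : algebraMap R' (FractionRing R') (d i) ≠ 0 := by simpa using hd0 i
    rw [← Finset.mul_prod_erase _ _ hi, map_mul, map_mul, e i]
    field_simp

/-- The degree of a rational map of projective varieties can be computed on affine cones. -/
theorem rationalMapDegree_eq_finrank (φ : R →ₐ[k] R') (hφ : Function.Injective φ)
    (hgr : ∀ n, ∀ a ∈ 𝒜 n, φ a ∈ ℬ n) (h𝒜 : ⨆ n, 𝒜 n = ⊤) (hℬ : ⨆ n, ℬ n = ⊤)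
    (hind : iSupIndep ℬ) {h : R} (hh : h ∈ 𝒜 1) (h0 : h ≠ 0)
    [Algebra (FractionRing R) (FractionRing R')]
    (hRR' : ∀ a, algebraMap (FractionRing R) (FractionRing R') (algebraMap R _ a) =
      algebraMap R' _ (φ a)) [FiniteDimensional (FractionRing R) (FractionRing R')] :
    rationalMapDegree 𝒜 ℬ φ hφ hgr = Module.finrank (FractionRing R) (FractionRing R') := by
  classical
  have hpow : ∀ n, h ^ n ∈ 𝒜 n := fun n => by simpa using SetLike.pow_mem_graded n hh
  have hiR : Function.Injective (algebraMap R (FractionRing R)) := IsFractionRing.injective _ _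
  have hiR' : Function.Injective (algebraMap R' (FractionRing R')) := IsFractionRing.injective _ _
  let _ : Algebra (functionField 𝒜) (functionField ℬ) := (pullback 𝒜 ℬ φ hφ hgr).toAlgebra
  have hKL : ∀ x : functionField 𝒜, (algebraMap (functionField 𝒜) (functionField ℬ) x :
      FractionRing R') = algebraMap (FractionRing R) (FractionRing R') x := by
    rintro ⟨_, n, a, ha, b, hb, hb0, rfl⟩
    change IsFractionRing.map (K := FractionRing R) (L := FractionRing R') (j := φ.toRingHom) hφ
      (algebraMap R _ a / algebraMap R _ b) = algebraMap (FractionRing R) (FractionRing R')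
        (algebraMap R _ a / algebraMap R _ b)
    simp [hRR', IsFractionRing.map]
  refine finrank_subfield_eq (functionField 𝒜) (functionField ℬ) hKL (fun ι b hb => ?_) ?_
  · let _ : Algebra R (FractionRing R') := ((algebraMap R' (FractionRing R')).comp φ.toRingHom).toAlgebra
    have : IsScalarTower R (FractionRing R) (FractionRing R') :=
      IsScalarTower.of_algebraMap_eq fun a => (hRR' a).symm
    rw [← LinearIndependent.iff_fractionRing R (FractionRing R), linearIndependent_iff']
    intro s r hr
    obtain ⟨m, d, hd0, a, ha, hba⟩ := exists_common_denominator ℬ s b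
    have hra : ∑ i ∈ s, φ (r i) * a i = 0 := hiR' (by
      rw [map_sum, map_zero, ← zero_mul (algebraMap R' (FractionRing R') d), ← hr, Finset.sum_mul]
      refine Finset.sum_congr rfl fun i hi => ?_
      rw [map_mul, ← hba i hi, Algebra.smul_def, mul_assoc]
      rfl)
    choose c hc hcr using fun i => (Submodule.mem_iSup_iff_exists_finsupp 𝒜 (r i)).1
      (h𝒜 ▸ Submodule.mem_top)
    let t : Finset ℕ := s.biUnion fun i => (c i).support
    have hrt : ∀ i ∈ s, r i = ∑ n ∈ t, c i n := fun i hi => by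
      rw [← hcr i, Finsupp.sum_of_support_subset _
        (Finset.subset_biUnion_of_mem (fun i => (c i).support) hi) _ (by simp)]
    -- All `a i` have degree `m`, so the coefficients of degree `n` contribute exactly the component
    -- of degree `n + m` of the relation.
    have hcomp : ∀ n ∈ t, ∑ i ∈ s, φ (c i n) * a i = 0 := by
      have hshift : iSupIndep fun n => ℬ (n + m) := hind.comp (add_left_injective m)
      refine (iSupIndep_iff_finsetSum_eq_zero_imp_eq_zero _).1 hshift t _ (fun n _ => ?_) ?_
      · exact sum_mem fun i hi => SetLike.GradedMul.mul_mem (hgr n _ (hc i n)) (ha i hi)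
      · rw [Finset.sum_comm, ← hra]
        refine Finset.sum_congr rfl fun i hi => ?_
        rw [hrt i hi, map_sum, Finset.sum_mul]
    have hc0 : ∀ n ∈ t, ∀ i ∈ s, c i n = 0 := by
      intro n hn
      -- Division by `h ^ n` turns the homogeneous coefficients into elements of the degree-zero
      -- field, over which the `b i` are independent.
      let x : ι → functionField 𝒜 := fun i => ⟨algebraMap R _ (c i n) / algebraMap R _ (h ^ n),
        n, _, hc i n, _, hpow n, pow_ne_zero _ h0, rfl⟩
      have hx : ∑ i ∈ s, x i • b i = 0 := by
        have hd' : algebraMap R' (FractionRing R') d ≠ 0 := by simpa using hiR'.ne hd0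
        refine Subtype.ext (mul_right_cancel₀ hd' ?_)
        have h1 := congrArg (algebraMap R' (FractionRing R')) (hcomp n hn)
        rw [map_sum, map_zero] at h1
        rw [AddSubmonoidClass.coe_finsetSum, Finset.sum_mul, ZeroMemClass.coe_zero, zero_mul,
          ← mul_zero (algebraMap R' (FractionRing R') (φ (h ^ n)))⁻¹, ← h1, Finset.mul_sum]
        refine Finset.sum_congr rfl fun i hi => ?_
        rw [Algebra.smul_def, MulMemClass.coe_mul, hKL, mul_assoc, hba i hi, map_div₀, hRR', hRR',
          map_mul]
        ring
      intro i hi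
      have := congrArg Subtype.val (linearIndependent_iff'.1 hb s x hx i hi)
      simpa [x, h0] using this
    intro i hi
    rw [hrt i hi]
    exact Finset.sum_eq_zero fun n hn => hc0 n hn i hi
  -- The span is a ring, because `functionField ℬ` is closed under products. It contains each
  -- homogeneous `y` of degree `n` as `(y / φ(h)ⁿ) φ(h)ⁿ`, hence `R'`, and it is closed under
  -- inverses because the extension is algebraic.
  · let P := Algebra.adjoin (FractionRing R) (functionField ℬ : Set (FractionRing R'))
    have hP : (P.toSubmodule : Submodule (FractionRing R) (FractionRing R')) =
        Submodule.span (FractionRing R) (functionField ℬ : Set (FractionRing R')) := by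
      rw [Algebra.adjoin_eq_span]
      congr 1
      exact congrArg SetLike.coe (Submonoid.closure_eq (functionField ℬ).toSubmonoid)
    have hR'P : ∀ y : R', algebraMap R' (FractionRing R') y ∈ P := by
      intro y
      have hy : y ∈ ⨆ n, ℬ n := hℬ ▸ Submodule.mem_top
      obtain ⟨c, hc, rfl⟩ := (Submodule.mem_iSup_iff_exists_finsupp ℬ y).1 hy
      rw [Finsupp.sum, map_sum]
      refine sum_mem fun n _ => ?_
      have hφh : φ (h ^ n) ≠ 0 := by simpa using hφ.ne (pow_ne_zero n h0)
      have h1 : algebraMap R' (FractionRing R') (c n) / algebraMap R' _ (φ (h ^ n)) ∈ P :=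
        Algebra.subset_adjoin ⟨n, _, hc n, _, hgr n _ (hpow n), hφh, rfl⟩
      have h2 := P.mul_mem h1 (P.algebraMap_mem (algebraMap R _ (h ^ n)))
      rwa [hRR', div_mul_cancel₀ _ (by simpa using hiR'.ne hφh)] at h2
    rw [← hP, eq_top_iff]
    intro z _
    obtain ⟨x, y, _, rfl⟩ := IsFractionRing.div_surjective R' z
    rw [div_eq_mul_inv]
    refine P.mul_mem (hR'P x) (P.inv_mem_of_algebraic (x := ⟨_, hR'P y⟩) ?_)
    exact Algebra.IsAlgebraic.isAlgebraic _

end GradedDomain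

/-! ### Evaluation on charts, and independence of points -/

namespace ProjectiveVariety

variable {k : Type*} [Field k] {N : ℕ}

theorem exists_isHomogeneous_one_aeval (f : Module.Dual k (Fin (N + 1) → k)) :
    ∃ p : MvPolynomial (Fin (N + 1)) k, p.IsHomogeneous 1 ∧
      ∀ v, MvPolynomial.aeval v p = f v := by
  refine ⟨∑ i, f (Pi.single i 1) • MvPolynomial.X i, ?_, fun v => ?_⟩
  · exact (MvPolynomial.homogeneousSubmodule (Fin (N + 1)) k 1).sum_mem fun i _ =>
      Submodule.smul_mem _ _ (MvPolynomial.isHomogeneous_X _ i)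
  · rw [map_sum, LinearMap.pi_apply_eq_sum_univ f v]
    refine Finset.sum_congr rfl fun i _ => ?_
    rw [map_smul, MvPolynomial.aeval_X, smul_eq_mul, smul_eq_mul, mul_comm]
    congr 3
    ext j
    simp [Pi.single_apply, eq_comm]

theorem exists_dual_of_isHomogeneous_one {p : MvPolynomial (Fin (N + 1)) k}
    (hp : p.IsHomogeneous 1) : ∃ f : Module.Dual k (Fin (N + 1) → k),
      ∀ v, MvPolynomial.aeval v p = f v := by
  change p ∈ MvPolynomial.homogeneousSubmodule (Fin (N + 1)) k 1 at hp
  rw [MvPolynomial.homogeneousSubmodule_one_eq_span_X] at hp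
  induction hp using Submodule.span_induction with
  | mem x hx =>
    obtain ⟨i, rfl⟩ := hx
    exact ⟨LinearMap.proj i, fun v => by simp⟩
  | zero => exact ⟨0, fun v => by simp⟩
  | add x y _ _ hx hy =>
    obtain ⟨f, hf⟩ := hx
    obtain ⟨g, hg⟩ := hy
    exact ⟨f + g, fun v => by rw [map_add, hf, hg, LinearMap.add_apply]⟩
  | smul c x _ hx =>
    obtain ⟨f, hf⟩ := hx
    exact ⟨c • f, fun v => by rw [map_smul, hf, LinearMap.smul_apply]⟩

/-- Regular functions on `D(h)` can be evaluated at the points of `D(h)`. -/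
theorem exists_evalChart (X : ProjectiveVariety k N) (h : X.piece 1) (v : X.cone)
    (hv : X.evalAt v h ≠ 0) : ∃ χ : X.chartRing h →ₐ[k] k, ∀ (z : X.chartRing h) (m : ℕ)
      (f : X.coordRing), (z : FractionRing X.coordRing) * algebraMap _ _ (h : X.coordRing) ^ m =
        algebraMap _ _ f → χ z * X.evalAt v h ^ m = X.evalAt v f := by
  choose m f hf e using fun z : X.chartRing h => z.2
  have hh : algebraMap X.coordRing (FractionRing X.coordRing) h ≠ 0 := by
    simpa using fun h' : (h : X.coordRing) = 0 => hv (by rw [h', map_zero])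
  -- The value is defined by a chosen representation `f / h ^ m`; `key` shows that any
  -- representation gives the same value, and compatibility with the operations follows.
  let χ : X.chartRing h → k := fun z => X.evalAt v (f z) / X.evalAt v h ^ m z
  have key : ∀ (z : X.chartRing h) (n : ℕ) (g : X.coordRing),
      (z : FractionRing X.coordRing) * algebraMap _ _ (h : X.coordRing) ^ n =
        algebraMap _ _ g → χ z * X.evalAt v h ^ n = X.evalAt v g := by
    intro z n g hg
    have h1 : f z * (h : X.coordRing) ^ n = g * (h : X.coordRing) ^ m z :=
      IsFractionRing.injective X.coordRing (FractionRing X.coordRing) (by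
        rw [map_mul, map_mul, map_pow, map_pow, ← e, ← hg]; ring)
    have h2 := congrArg (X.evalAt v) h1
    rw [map_mul, map_mul, map_pow, map_pow] at h2
    simp only [χ]
    field_simp
    rw [h2, mul_comm]
  have key' : ∀ (z : X.chartRing h) (n : ℕ) (g : X.coordRing) (c : k),
      (z : FractionRing X.coordRing) * algebraMap _ _ (h : X.coordRing) ^ n =
        algebraMap _ _ g → c * X.evalAt v h ^ n = X.evalAt v g → χ z = c := fun z n g c h1 h2 =>
    mul_right_cancel₀ (pow_ne_zero n hv) ((key z n g h1).trans h2.symm)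
  have hc : ∀ c : k, χ (algebraMap k _ c) = c := fun c =>
    key' _ 0 (algebraMap k _ c) c (by
      rw [pow_zero, mul_one, ← IsScalarTower.algebraMap_apply]; rfl) (by simp)
  have hmul : ∀ x y, χ (x * y) = χ x * χ y := fun x y =>
    key' _ (m x + m y) (f x * f y) _
      (by rw [map_mul, ← e x, ← e y, MulMemClass.coe_mul]; ring)
      (by rw [map_mul, ← key x _ _ (e x), ← key y _ _ (e y)]; ring)
  have hadd : ∀ x y, χ (x + y) = χ x + χ y := fun x y =>
    key' _ (m x + m y) (f x * h ^ m y + f y * h ^ m x) _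
      (by rw [map_add, map_mul, map_mul, map_pow, map_pow, ← e x, ← e y, AddMemClass.coe_add]; ring)
      (by rw [map_add, map_mul, map_mul, map_pow, map_pow, ← key x _ _ (e x),
            ← key y _ _ (e y)]; ring)
  refine ⟨{ toFun := χ, map_one' := ?_, map_mul' := hmul, map_zero' := ?_, map_add' := hadd,
            commutes' := hc }, key⟩
  · simpa using hc 1
  · simpa using hc 0

theorem div_mem_chartRing (X : ProjectiveVariety k N) (h : X.piece 1) (h0 : h ≠ 0)
    {l : X.coordRing} (hl : l ∈ X.piece 1) :
    algebraMap X.coordRing (FractionRing X.coordRing) l / algebraMap _ _ (h : X.coordRing) ∈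
      X.chartRing h := by
  refine ⟨1, l, hl, ?_⟩
  rw [pow_one, div_mul_cancel₀]
  simpa using h0

/-- On a completely embedded variety with `d`-very ample `𝒪(1)`, any `d + 1` distinct points are
linearly independent. -/
theorem linearIndepOn_rep (X : ProjectiveVariety k N) [Infinite k] (hemb : X.IsCompletelyEmbedded)
    {d : ℕ} (hva : X.IsVeryAmple d) (S : Finset (ℙ k (Fin (N + 1) → k)))
    (hS : ∀ p ∈ S, p ∈ X.points) (hcard : S.card ≤ d + 1) :
    LinearIndepOn k Projectivization.rep (S : Set (ℙ k (Fin (N + 1) → k))) := by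
  classical
  -- Over an infinite field some linear form vanishes at none of the finitely many points, so `S`
  -- lies in a single chart `D(h)`.
  obtain ⟨η, hη⟩ := Module.exists_dual_forall_apply_ne_zero (K := k)
    (fun p : S => p.1.rep) fun p => p.1.rep_nonzero
  obtain ⟨hp, hp1, hpη⟩ := exists_isHomogeneous_one_aeval η
  let h : X.piece 1 := ⟨X.toCoordRing hp, hp, hp1, rfl⟩
  let P : S → X.cone := fun p => ⟨p.1.rep, hS p p.2⟩
  have hP : ∀ p, X.evalAt (P p) h ≠ 0 := fun p => by
    change X.evalAt (P p) (X.toCoordRing hp) ≠ 0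
    rw [evalAt_toCoordRing, hpη]
    exact hη p
  choose χ hχ using fun p => X.exists_evalChart h (P p) (hP p)
  have hχ1 : ∀ (p : S) (z : X.chartRing h) (l : X.coordRing), (z : FractionRing X.coordRing) =
      algebraMap _ _ l / algebraMap _ _ (h : X.coordRing) →
        χ p z * X.evalAt (P p) h = X.evalAt (P p) l := fun p z l hz => by
    have := hχ p z 1 l
    rw [pow_one, pow_one] at this
    refine this ?_
    rw [hz, div_mul_cancel₀]
    simpa using fun h' : (h : X.coordRing) = 0 => hP p (by rw [h', map_zero])
  let Φ : X.chartRing h →ₐ[k] (S → k) := AlgHom.pi χ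
  -- `J` is the ideal of `S` as a reduced subscheme; its quotient embeds in `S → k`, which bounds
  -- the length by the number of points.
  let J : Ideal (X.chartRing h) := RingHom.ker Φ
  have hinj := Ideal.kerLiftAlg_injective Φ
  have hfin : Module.Finite k (X.chartRing h ⧸ J) :=
    Module.Finite.of_injective (Ideal.kerLiftAlg Φ).toLinearMap hinj
  have hrank : Module.finrank k (X.chartRing h ⧸ J) ≤ d + 1 :=
    (LinearMap.finrank_le_finrank_of_injective (f := (Ideal.kerLiftAlg Φ).toLinearMap)
      hinj).trans (by simpa using hcard)
  suffices hsep : ∀ p : S, ∃ f : Module.Dual k (Fin (N + 1) → k), f p.1.rep ≠ 0 ∧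
      ∀ q ≠ p, f q.1.rep = 0 by
    refine linearIndependent_iff'.2 fun s g hg p hp => ?_
    obtain ⟨f, hf1, hf2⟩ := hsep p
    have := congrArg f hg
    rw [map_sum, Finset.sum_eq_single_of_mem p hp fun q _ hq => by
      rw [map_smul, hf2 q hq, smul_zero], map_smul, map_zero, smul_eq_mul] at this
    exact (mul_eq_zero.1 this).resolve_right hf1
  intro p
  by_cases h0 : h = 0
  · exact absurd (by rw [h0, ZeroMemClass.coe_zero, map_zero]) (hP p)
  -- For `q = p` the form `0` is a dummy: the product `e` below omits this factor.
  have hsep : ∀ q : S, ∃ l ∈ X.piece 1, q ≠ p → X.evalAt (P q) l = 0 ∧ X.evalAt (P p) l ≠ 0 := by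
    intro q
    by_cases hqp : q = p
    · exact ⟨0, zero_mem _, fun h => absurd hqp h⟩
    obtain ⟨f, hf1, hf2⟩ := Submodule.exists_dual_map_eq_bot_of_notMem (x := p.1.rep)
      (p := Submodule.span k {q.1.rep}) (fun hmem => by
        obtain ⟨c, hc⟩ := Submodule.mem_span_singleton.1 hmem
        refine hqp (Subtype.ext ?_).symm
        rw [← p.1.mk_rep, ← q.1.mk_rep]
        exact (Projectivization.mk_eq_mk_iff' _ _ _ _ _).2 ⟨c, hc⟩) inferInstance
    obtain ⟨l, hl1, hl⟩ := exists_isHomogeneous_one_aeval f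
    refine ⟨X.toCoordRing l, ⟨l, hl1, rfl⟩, fun _ => ⟨?_, ?_⟩⟩
    · rw [evalAt_toCoordRing, hl]
      have : f q.1.rep ∈ (Submodule.span k {q.1.rep}).map f :=
        ⟨_, Submodule.mem_span_singleton_self _, rfl⟩
      rw [hf2] at this
      exact (Submodule.mem_bot k).1 this
    · rwa [evalAt_toCoordRing, hl]
  choose l hl1 hl using hsep
  let y : S → X.chartRing h := fun q => ⟨_, X.div_mem_chartRing h h0 (hl1 q)⟩
  -- The regular function `e` vanishes at all points of `S` but `p`. Modulo `J` it is the
  -- restriction of a global section, which by `hemb` is a linear form; this form separates `p` from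
  -- the other points.
  let e : X.chartRing h := ∏ q ∈ Finset.univ.erase p, y q
  have hy : ∀ q r, χ r (y q) * X.evalAt (P r) h = X.evalAt (P r) (l q) := fun q r =>
    hχ1 r _ _ rfl
  obtain ⟨s, hs⟩ := hva h h0 J hfin hrank (Ideal.Quotient.mk J e)
  obtain ⟨w, ⟨f, hf1, rfl⟩, hf⟩ := hemb s s.2
  obtain ⟨φ, hφ⟩ := exists_dual_of_isHomogeneous_one hf1
  let x : X.chartRing h := ⟨_, s.2 h h0⟩
  have hxe : ∀ r, χ r x = χ r e := by
    have : x - e ∈ J := Ideal.Quotient.eq.1 hs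
    rw [RingHom.mem_ker, map_sub, sub_eq_zero] at this
    exact fun r => congrFun this r
  have hxφ : ∀ r : S, χ r e * X.evalAt (P r) h = φ r.1.rep := fun r => by
    rw [← hxe r, hχ1 r x (X.toCoordRing f) (by simp only [x, hf]; rfl), evalAt_toCoordRing, hφ]
  refine ⟨φ, ?_, fun q hq => ?_⟩
  · rw [← hxφ, map_prod]
    refine mul_ne_zero (Finset.prod_ne_zero_iff.2 fun q hq h' => ?_) (hP p)
    refine (hl q (Finset.ne_of_mem_erase hq)).2 ?_
    rw [← hy, h', zero_mul]
  · rw [← hxφ, map_prod, Finset.prod_eq_zero (Finset.mem_erase.2 ⟨hq, Finset.mem_univ q⟩),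
      zero_mul]
    have := hy q q
    rw [(hl q hq).1] at this
    exact (mul_eq_zero.1 this).resolve_right (hP q)

/-- Sums of vectors on pairwise distinct lines of the cone determine their summands. -/
theorem exists_perm_of_sum_eq (X : ProjectiveVariety k N) [Infinite k]
    (hemb : X.IsCompletelyEmbedded) {d : ℕ} (hva : X.IsVeryAmple d) {ι : Type*} [Fintype ι]
    (hι : Fintype.card ι + Fintype.card ι ≤ d + 1) {a b : ι → Fin (N + 1) → k}
    (ha : ∀ i, a i ∈ X.cone) (hb : ∀ i, b i ∈ X.cone) (ha0 : ∀ i, a i ≠ 0) (hb0 : ∀ i, b i ≠ 0)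
    (hainj : Function.Injective fun i => Projectivization.mk k (a i) (ha0 i))
    (hbinj : Function.Injective fun i => Projectivization.mk k (b i) (hb0 i))
    (hab : ∑ i, a i = ∑ i, b i) : ∃ σ : Equiv.Perm ι, ∀ i, b i = a (σ i) := by
  classical
  let p : ι → ℙ k (Fin (N + 1) → k) := fun i => Projectivization.mk k (a i) (ha0 i)
  let q : ι → ℙ k (Fin (N + 1) → k) := fun i => Projectivization.mk k (b i) (hb0 i)
  let S := Finset.univ.image p ∪ Finset.univ.image q
  have hpS : ∀ i, p i ∈ S := fun i =>
    Finset.mem_union_left _ (Finset.mem_image_of_mem p (Finset.mem_univ i))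
  have hqS : ∀ i, q i ∈ S := fun i =>
    Finset.mem_union_right _ (Finset.mem_image_of_mem q (Finset.mem_univ i))
  have hind := X.linearIndepOn_rep hemb hva S (fun r hr => by
      rcases Finset.mem_union.1 hr with hr | hr <;> obtain ⟨i, _, rfl⟩ := Finset.mem_image.1 hr
      · exact X.mk_mem_points (ha i) (ha0 i)
      · exact X.mk_mem_points (hb i) (hb0 i))
    (((Finset.card_union_le _ _).trans
      (add_le_add Finset.card_image_le Finset.card_image_le)).trans hι)
  have hscale : ∀ (v : Fin (N + 1) → k) (hv : v ≠ 0), ∃ c : k, c ≠ 0 ∧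
      v = c • (Projectivization.mk k v hv).rep := fun v hv => by
    obtain ⟨c, hc⟩ := Projectivization.exists_smul_eq_mk_rep k v hv
    exact ⟨(c⁻¹ : kˣ), (c⁻¹).ne_zero, by rw [← hc]; exact (inv_smul_smul c v).symm⟩
  choose α hα0 hα using fun i => hscale (a i) (ha0 i)
  choose β hβ0 hβ using fun i => hscale (b i) (hb0 i)
  -- The two sums are one vector written twice in terms of the independent representatives of `S`,
  -- so the coefficients agree.
  have hfin : ∑ i, Finsupp.single (p i) (α i) = ∑ i, Finsupp.single (q i) (β i) := by
    refine linearIndepOn_iffₛ.1 hind _ (Submodule.sum_mem _ fun i _ =>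
      Finsupp.single_mem_supported _ _ (hpS i)) _ (Submodule.sum_mem _ fun i _ =>
      Finsupp.single_mem_supported _ _ (hqS i)) ?_
    rw [map_sum, map_sum]
    simp only [Finsupp.linearCombination_single, p, q, ← hα, ← hβ]
    exact hab
  -- Compare coefficients at `q i`. On the right it is `β i ≠ 0`, as the `q j` are distinct, so some
  -- `p j` equals `q i`; as the `p j` are distinct too, `α j = β i`.
  have hex : ∀ i, ∃ j, b i = a j := fun i => by
    have h1 := DFunLike.congr_fun hfin (q i)
    simp only [Finsupp.finsetSum_apply] at h1
    rw [Finset.sum_eq_single i (fun j _ hj => Finsupp.single_eq_of_ne fun h => hj (hbinj h.symm))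
      (by simp), Finsupp.single_eq_same] at h1
    obtain ⟨j, hj⟩ : ∃ j, p j = q i := by
      by_contra! hcon
      refine hβ0 i (h1 ▸ Finset.sum_eq_zero fun j _ => ?_)
      exact Finsupp.single_eq_of_ne (hcon j).symm
    refine ⟨j, ?_⟩
    rw [← hj, Finset.sum_eq_single j
      (fun l _ hl => Finsupp.single_eq_of_ne fun h => hl (hainj h.symm)) (by simp),
      Finsupp.single_eq_same] at h1
    rw [hα j, hβ i, h1]
    exact congrArg (fun r => β i • Projectivization.rep r) hj.symm
  choose σ hσ using hex
  have hσinj : Function.Injective σ := fun i j hij => hbinj (by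
    have : b i = b j := by rw [hσ i, hσ j, hij]
    simp only [this])
  exact ⟨Equiv.ofBijective σ (Finite.injective_iff_bijective.1 hσinj), hσ⟩

/-! ### Embedded joins and secant varieties -/

theorem ext_ideal {X Y : ProjectiveVariety k N} (h : X.ideal = Y.ideal) : X = Y := by
  cases X; cases Y; cases h; rfl

theorem aeval_translate (t v : Fin (N + 1) → k) (p : MvPolynomial (Fin (N + 1)) k) :
    MvPolynomial.aeval v (MvPolynomial.aeval
      (fun i => MvPolynomial.X i + MvPolynomial.C (t i)) p) = MvPolynomial.aeval (v + t) p := by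
  rw [← AlgHom.comp_apply]
  congr 1
  ext i
  simp

section AlgClosed

variable [IsAlgClosed k]

theorem zero_mem_cone (X : ProjectiveVariety k N) : 0 ∈ X.cone := by
  obtain ⟨v, hv, _⟩ := X.exists_cone_ne_zero
  simpa using X.smul_mem_cone 0 hv

/-- The condition that the sum be nonzero can be dropped, since the origin lies on every cone. -/
theorem mem_joinOfFamily_ideal_iff {ι : Type*} [Fintype ι] [Nonempty ι]
    (X : ι → ProjectiveVariety k N) (f : MvPolynomial (Fin (N + 1)) k) :
    f ∈ (joinOfFamily X).ideal ↔ ∀ c : ι → Fin (N + 1) → k, (∀ i, c i ∈ (X i).cone) →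
      MvPolynomial.aeval (∑ i, c i) f = 0 := by
  refine ⟨fun h c hc => ?_, fun h => (mem_vanishingIdeal_spans_iff X f).2 fun c hc _ => h c hc⟩
  by_cases h0 : ∑ i, c i = 0
  · rw [h0]
    exact (joinOfFamily X).zero_mem_cone f h
  · exact (mem_vanishingIdeal_spans_iff X f).1 h c hc h0

theorem sum_mem_joinOfFamily_cone {ι : Type*} [Fintype ι] [Nonempty ι]
    (X : ι → ProjectiveVariety k N) {c : ι → Fin (N + 1) → k} (hc : ∀ i, c i ∈ (X i).cone) :
    ∑ i, c i ∈ (joinOfFamily X).cone :=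
  fun f hf => (mem_joinOfFamily_ideal_iff X f).1 hf c hc

theorem embeddedJoin_secantVariety_two (X : ProjectiveVariety k N) :
    X.embeddedJoin (X.secantVariety 2) = X.secantVariety 3 := by
  refine ext_ideal (Ideal.ext fun f => ?_)
  rw [embeddedJoin, secantVariety, secantVariety, mem_joinOfFamily_ideal_iff,
    mem_joinOfFamily_ideal_iff]
  constructor
  · intro h c hc
    have := h ![c 0, c 1 + c 2]
    simp only [Fin.forall_fin_two, Fin.sum_univ_two] at this
    rw [Fin.sum_univ_three, add_assoc]
    refine this ⟨hc 0, ?_⟩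
    have h2 := sum_mem_joinOfFamily_cone (fun _ : Fin 2 => X) (c := ![c 1, c 2])
      (by simpa [Fin.forall_fin_two] using ⟨hc 1, hc 2⟩)
    simpa [Fin.sum_univ_two] using h2
  · intro h c hc
    -- The vector `c 1` is only in the closure of the sums of two vectors of the cone. With `c 0`
    -- fixed, the translate of `f` vanishes on these sums, hence on their closure.
    have h1 : MvPolynomial.aeval (fun i => MvPolynomial.X i + MvPolynomial.C (c 0 i)) f ∈
        (joinOfFamily fun _ : Fin 2 => X).ideal := by
      rw [mem_joinOfFamily_ideal_iff]
      intro b hb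
      rw [aeval_translate, Fin.sum_univ_two, add_comm (b 0 + b 1), ← add_assoc]
      have := h ![c 0, b 0, b 1]
      simp only [Fin.sum_univ_three] at this
      refine this fun i => ?_
      fin_cases i
      exacts [hc 0, hb 0, hb 1]
    have h2 := hc 1 _ h1
    rw [aeval_translate] at h2
    rwa [Fin.sum_univ_two, add_comm (c 0)]

end AlgClosed

end ProjectiveVariety

/-! ### Gradings of the coordinate rings -/

namespace ProjectiveVariety

variable {k : Type*} [Field k] {N : ℕ}

theorem iSup_piece (X : ProjectiveVariety k N) : ⨆ n, X.piece n = ⊤ := by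
  rw [eq_top_iff]
  intro a _
  obtain ⟨f, rfl⟩ := X.toCoordRing_surjective a
  rw [← MvPolynomial.sum_homogeneousComponent f, map_sum]
  exact Submodule.sum_mem _ fun n _ => Submodule.mem_iSup_of_mem n
    ⟨_, MvPolynomial.homogeneousComponent_isHomogeneous n f, rfl⟩

theorem coord_mem_piece (X : ProjectiveVariety k N) (i : Fin (N + 1)) : X.coord i ∈ X.piece 1 :=
  ⟨_, MvPolynomial.isHomogeneous_X _ i, rfl⟩

theorem coordRing_algHom_ext (X : ProjectiveVariety k N) {C : Type*} [CommRing C] [Algebra k C]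
    {f g : X.coordRing →ₐ[k] C} (h : ∀ i, f (X.coord i) = g (X.coord i)) : f = g := by
  have : f.comp X.toCoordRing = g.comp X.toCoordRing := MvPolynomial.algHom_ext h
  ext a
  obtain ⟨p, rfl⟩ := X.toCoordRing_surjective a
  exact DFunLike.congr_fun this p

theorem evalAt_smul (X : ProjectiveVariety k N) (c : k) (v : X.cone) {n : ℕ} {a : X.coordRing}
    (ha : a ∈ X.piece n) : X.evalAt ⟨c • v.1, X.smul_mem_cone c v.2⟩ a = c ^ n * X.evalAt v a := by
  obtain ⟨f, hf, rfl⟩ := ha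
  exact aeval_smul_of_isHomogeneous hf c v.1

theorem iSup_ruledJoinPiece (X Y : ProjectiveVariety k N) : ⨆ n, ruledJoinPiece X Y n = ⊤ := by
  rw [eq_top_iff]
  intro t _
  induction t using TensorProduct.induction_on with
  | zero => exact zero_mem _
  | add x y hx hy => exact add_mem (hx trivial) (hy trivial)
  | tmul a b =>
    have ha : a ∈ ⨆ n, X.piece n := X.iSup_piece ▸ Submodule.mem_top
    have hb : b ∈ ⨆ n, Y.piece n := Y.iSup_piece ▸ Submodule.mem_top
    induction ha using Submodule.iSup_induction' with
    | zero => rw [TensorProduct.zero_tmul]; exact zero_mem _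
    | add x y _ _ hx hy => rw [TensorProduct.add_tmul]; exact add_mem (hx trivial) (hy trivial)
    | mem i a ha =>
      induction hb using Submodule.iSup_induction' with
      | zero => rw [TensorProduct.tmul_zero]; exact zero_mem _
      | add x y _ _ hx hy => rw [TensorProduct.tmul_add]; exact add_mem (hx trivial) (hy trivial)
      | mem j b hb =>
        exact Submodule.mem_iSup_of_mem (i + j)
          (Submodule.subset_span ⟨i, j, rfl, a, ha, b, hb, rfl⟩)

theorem eval_smul_of_mem_ruledJoinPiece (X Y : ProjectiveVariety k N) (c : k) (v : X.cone)
    (w : Y.cone) {n : ℕ} {t : RuledJoinRing X Y} (ht : t ∈ ruledJoinPiece X Y n) :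
    Y.evalAt ⟨c • w.1, Y.smul_mem_cone c w.2⟩
      (evalLeft X Y ⟨c • v.1, X.smul_mem_cone c v.2⟩ t) =
        c ^ n * Y.evalAt w (evalLeft X Y v t) := by
  induction ht using Submodule.span_induction with
  | mem t ht =>
    obtain ⟨i, j, rfl, a, ha, b, hb, rfl⟩ := ht
    simp only [evalLeft, Algebra.TensorProduct.lift_tmul, map_mul, AlgHom.comp_apply,
      Algebra.ofId_apply, AlgHom.commutes, AlgHom.id_apply, evalAt_smul X c v ha,
      evalAt_smul Y c w hb]
    simp only [Algebra.algebraMap_self, RingHom.id_apply]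
    ring
  | zero => simp
  | add x y _ _ hx hy => simp only [map_add, hx, hy, mul_add]
  | smul a x _ hx => simp only [map_smul, hx, smul_eq_mul]; ring

theorem iSupIndep_ruledJoinPiece [IsAlgClosed k] (X Y : ProjectiveVariety k N) :
    iSupIndep (ruledJoinPiece X Y) := by
  refine (iSupIndep_iff_finsetSum_eq_zero_imp_eq_zero _).2 fun s t ht hsum n hn => ?_
  refine eq_zero_of_eval X Y _ fun v w => ?_
  -- Scaling both points by `c` multiplies the term of degree `m` by `c ^ m`. So the relation says
  -- that `q` vanishes at every `c` in the infinite field `k`, and its coefficients are zero.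
  let q : Polynomial k := ∑ m ∈ s, Polynomial.monomial m (Y.evalAt w (evalLeft X Y v (t m)))
  have hq : q = 0 := Polynomial.funext fun c => by
    simp only [q, Polynomial.eval_finsetSum, Polynomial.eval_monomial, Polynomial.eval_zero]
    have := congrArg (fun x => Y.evalAt ⟨c • w.1, Y.smul_mem_cone c w.2⟩
      (evalLeft X Y ⟨c • v.1, X.smul_mem_cone c v.2⟩ x)) hsum
    simp only [map_sum, map_zero] at this
    rw [← this]
    refine Finset.sum_congr rfl fun m hm => ?_
    rw [eval_smul_of_mem_ruledJoinPiece X Y c v w (ht m hm), mul_comm]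
  have := congrArg (Polynomial.coeff · n) hq
  simpa [q, Polynomial.finsetSum_coeff, Polynomial.coeff_monomial, hn] using this

/-! ### Powers of the affine cone -/

variable (X : ProjectiveVariety k N) (ι : Type*)

/-- The `k`-points of the power of the affine cone over `X`. -/
def conePower : Set (ι × Fin (N + 1) → k) := {v | ∀ i, (fun j => v (i, j)) ∈ X.cone}

/-- The ideal of the power of the affine cone over `X`. -/
def conePowerIdeal : Ideal (MvPolynomial (ι × Fin (N + 1)) k) :=
  MvPolynomial.vanishingIdeal k (X.conePower ι)

/-- The coordinate ring of the power of the affine cone over `X`. -/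
abbrev ConePowerRing : Type _ := MvPolynomial (ι × Fin (N + 1)) k ⧸ X.conePowerIdeal ι

/-- The coordinates on the power of the affine cone over `X`. -/
def conePowerCoord {ι : Type*} (i : ι) (j : Fin (N + 1)) : X.ConePowerRing ι :=
  Ideal.Quotient.mk _ (MvPolynomial.X (i, j))

variable {ι}

/-- A power of an irreducible variety is irreducible: the factors in `s`, where `a` and `b` may
differ, are made equal one at a time, using that the ideal of `X` is prime. -/
theorem exists_mem_conePower_aeval_ne_zero [IsAlgClosed k] (s : Finset ι)
    {f g : MvPolynomial (ι × Fin (N + 1)) k} {a b : ι × Fin (N + 1) → k}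
    (ha : a ∈ X.conePower ι) (hb : b ∈ X.conePower ι) (hab : ∀ p, p.1 ∉ s → a p = b p)
    (hf : MvPolynomial.aeval a f ≠ 0) (hg : MvPolynomial.aeval b g ≠ 0) :
    ∃ c ∈ X.conePower ι, MvPolynomial.aeval c f ≠ 0 ∧ MvPolynomial.aeval c g ≠ 0 := by
  classical
  induction s using Finset.induction_on generalizing a b with
  | empty =>
    obtain rfl : a = b := funext fun p => hab p (by simp)
    exact ⟨a, ha, hf, hg⟩
  | insert l s hl ih =>
    -- `upd` replaces the factor `l` of a point, and `part` evaluates all the other factors, leaving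
    -- a polynomial in the factor `l` alone.
    let upd : (ι × Fin (N + 1) → k) → (Fin (N + 1) → k) → ι × Fin (N + 1) → k :=
      fun a v p => if p.1 = l then v p.2 else a p
    let part : (ι × Fin (N + 1) → k) → MvPolynomial (ι × Fin (N + 1)) k →
        MvPolynomial (Fin (N + 1)) k := fun a f =>
      MvPolynomial.aeval (fun p => if p.1 = l then MvPolynomial.X p.2 else MvPolynomial.C (a p)) f
    have hpart : ∀ a v f, MvPolynomial.aeval v (part a f) = MvPolynomial.aeval (upd a v) f := by
      intro a v f
      simp only [part]
      rw [← AlgHom.comp_apply]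
      congr 1
      refine MvPolynomial.algHom_ext fun p => ?_
      by_cases hp : p.1 = l <;> simp [upd, hp]
    have hself : ∀ a : ι × Fin (N + 1) → k, upd a (fun j => a (l, j)) = a := fun a => by
      ext ⟨i, j⟩
      by_cases hi : i = l <;> simp [upd, hi]
    have hmem : ∀ a ∈ X.conePower ι, ∀ v ∈ X.cone, upd a v ∈ X.conePower ι := by
      intro a ha v hv i
      by_cases hi : i = l
      · simpa [upd, hi] using hv
      · simpa [upd, hi] using ha i
    have h1 : part a f ∉ X.ideal := fun h => hf (by
      have := (hpart a _ f).symm.trans (ha l _ h)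
      rwa [hself] at this)
    have h2 : part b g ∉ X.ideal := fun h => hg (by
      have := (hpart b _ g).symm.trans (hb l _ h)
      rwa [hself] at this)
    have h3 : part a f * part b g ∉ X.ideal := fun h => (X.isPrime.mem_or_mem h).elim h1 h2
    rw [mem_ideal_iff] at h3
    push Not at h3
    obtain ⟨v, hv, h3⟩ := h3
    rw [map_mul, hpart, hpart] at h3
    refine ih (hmem a ha v hv) (hmem b hb v hv) (fun p hp => ?_) (left_ne_zero_of_mul h3)
      (right_ne_zero_of_mul h3)
    by_cases hpl : p.1 = l
    · simp [upd, hpl]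
    · simp only [upd, hpl, if_false]
      exact hab p (by simp [hpl, hp])

instance [IsAlgClosed k] [Finite ι] : (X.conePowerIdeal ι).IsPrime := by
  have := Fintype.ofFinite ι
  refine ⟨fun h => ?_, fun {f g} hfg => ?_⟩
  · have h1 : (1 : MvPolynomial (ι × Fin (N + 1)) k) ∈ X.conePowerIdeal ι := h ▸ trivial
    have := h1 (0 : ι × Fin (N + 1) → k) fun i => X.zero_mem_cone
    simp at this
  · by_contra! hcon
    simp only [conePowerIdeal, MvPolynomial.mem_vanishingIdeal_iff] at hcon hfg
    push Not at hcon
    obtain ⟨⟨a, ha, hf⟩, b, hb, hg⟩ := hcon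
    obtain ⟨c, hc, h1, h2⟩ := X.exists_mem_conePower_aeval_ne_zero Finset.univ ha hb (by simp) hf hg
    have := hfg c hc
    rw [map_mul] at this
    exact mul_ne_zero h1 h2 this

/-- Evaluation at a point of the power of the affine cone. -/
def evalConePower (c : X.conePower ι) : X.ConePowerRing ι →ₐ[k] k :=
  Ideal.Quotient.liftₐ (X.conePowerIdeal ι) (MvPolynomial.aeval c.1) fun _ hf => hf c c.2

@[simp]
theorem evalConePower_coord (c : X.conePower ι) (i : ι) (j : Fin (N + 1)) :
    X.evalConePower c (X.conePowerCoord i j) = c.1 (i, j) := by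
  change MvPolynomial.aeval c.1 (MvPolynomial.X (i, j)) = _
  simp

theorem conePowerRing_algHom_ext {C : Type*} [CommRing C] [Algebra k C]
    {f g : X.ConePowerRing ι →ₐ[k] C}
    (h : ∀ i j, f (X.conePowerCoord i j) = g (X.conePowerCoord i j)) : f = g :=
  Ideal.Quotient.algHom_ext _ (MvPolynomial.algHom_ext fun p => h p.1 p.2)

/-- A factor of the power of the affine cone, on coordinate rings. -/
def coordHom (i : ι) : X.coordRing →ₐ[k] X.ConePowerRing ι :=
  Ideal.Quotient.liftₐ X.ideal (MvPolynomial.aeval (X.conePowerCoord i)) fun f hf => by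
    have h : MvPolynomial.aeval (X.conePowerCoord i) f =
        Ideal.Quotient.mkₐ k (X.conePowerIdeal ι) (MvPolynomial.rename (i, ·) f) := by
      rw [← AlgHom.comp_apply]
      congr 1
      exact MvPolynomial.algHom_ext fun j => by simp [conePowerCoord]
    rw [h]
    refine Ideal.Quotient.eq_zero_iff_mem.2 fun v hv => ?_
    rw [MvPolynomial.aeval_rename]
    exact hv i f hf

@[simp]
theorem coordHom_coord (i : ι) (j : Fin (N + 1)) :
    X.coordHom i (X.coord j) = X.conePowerCoord i j := by
  change MvPolynomial.aeval (X.conePowerCoord i) (MvPolynomial.X j) = _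
  simp

theorem algHom_mem_cone (χ : X.ConePowerRing ι →ₐ[k] k) (i : ι) :
    (fun j => χ (X.conePowerCoord i j)) ∈ X.cone := by
  intro f hf
  have h : MvPolynomial.aeval (fun j => χ (X.conePowerCoord i j)) =
      (χ.comp (X.coordHom i)).comp X.toCoordRing :=
    MvPolynomial.algHom_ext fun j => by
      change _ = χ (X.coordHom i (X.coord j))
      simp
  rw [h, AlgHom.comp_apply, (X.toCoordRing_eq_zero_iff f).2 hf, map_zero]

/-- A permutation of the factors of the power of the affine cone, as an endomorphism of the
coordinate ring. -/
def permHom (σ : Equiv.Perm ι) : X.ConePowerRing ι →ₐ[k] X.ConePowerRing ι :=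
  Ideal.Quotient.liftₐ (X.conePowerIdeal ι)
    ((Ideal.Quotient.mkₐ k _).comp (MvPolynomial.rename fun p => (σ p.1, p.2))) fun f hf => by
      refine Ideal.Quotient.eq_zero_iff_mem.2 fun v hv => ?_
      rw [RingHom.coe_coe, MvPolynomial.aeval_rename]
      exact hf _ fun i => hv (σ i)

@[simp]
theorem permHom_coord (σ : Equiv.Perm ι) (i : ι) (j : Fin (N + 1)) :
    X.permHom σ (X.conePowerCoord i j) = X.conePowerCoord (σ i) j := by
  change Ideal.Quotient.mkₐ k (X.conePowerIdeal ι)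
    (MvPolynomial.rename (fun p => (σ p.1, p.2)) (MvPolynomial.X (i, j))) = _
  simp [conePowerCoord]

/-- Permutations of the factors of the power of the affine cone, as automorphisms of the
coordinate ring. -/
def permAut : Equiv.Perm ι →* (X.ConePowerRing ι ≃ₐ[k] X.ConePowerRing ι) where
  toFun σ := AlgEquiv.ofAlgHom (X.permHom σ) (X.permHom σ⁻¹)
    (X.conePowerRing_algHom_ext fun i j => by simp) (X.conePowerRing_algHom_ext fun i j => by simp)
  map_one' := AlgEquiv.coe_toAlgHom_injective (X.conePowerRing_algHom_ext fun i j => by simp)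
  map_mul' σ τ := AlgEquiv.coe_toAlgHom_injective (X.conePowerRing_algHom_ext fun i j => by simp)

@[simp]
theorem permAut_coord (σ : Equiv.Perm ι) (i : ι) (j : Fin (N + 1)) :
    X.permAut σ (X.conePowerCoord i j) = X.conePowerCoord (σ i) j :=
  X.permHom_coord σ i j

end ProjectiveVariety

/-! ### Degrees in towers -/

/-- Degrees of function fields in a tower of affine varieties. -/
theorem exists_algebra_finrank_eq {k A R B : Type*} [Field k] [CommRing A] [IsDomain A]
    [Algebra k A] [CommRing R] [IsDomain R] [Algebra k R] [CommRing B] [IsDomain B] [Algebra k B]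
    {m n : ℕ} (f : A →ₐ[k] R) (hf : Function.Injective f) (g : R →ₐ[k] B)
    (hg : Function.Injective g) (hn : 0 < n)
    (hA : ∀ [Algebra (FractionRing A) (FractionRing B)]
      [IsScalarTower k (FractionRing A) (FractionRing B)],
      (∀ x, algebraMap (FractionRing A) (FractionRing B) (algebraMap A _ x) =
        algebraMap B _ ((g.comp f) x)) →
      Module.finrank (FractionRing A) (FractionRing B) = m * n)
    (hR : ∀ [Algebra (FractionRing R) (FractionRing B)]
      [IsScalarTower k (FractionRing R) (FractionRing B)],
      (∀ x, algebraMap (FractionRing R) (FractionRing B) (algebraMap R _ x) =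
        algebraMap B _ (g x)) →
      Module.finrank (FractionRing R) (FractionRing B) = n) :
    ∃ _ : Algebra (FractionRing A) (FractionRing R),
      (∀ x, algebraMap (FractionRing A) (FractionRing R) (algebraMap A _ x) =
        algebraMap R _ (f x)) ∧ Module.finrank (FractionRing A) (FractionRing R) = m := by
  -- The field extensions are constructed here from `f` and `g`; this is why `hA` and `hR` are
  -- quantified over all compatible algebra structures.
  let _ : Algebra (FractionRing A) (FractionRing R) :=
    (IsFractionRing.map (K := FractionRing A) (L := FractionRing R) (j := f.toRingHom)
      hf).toAlgebra
  let _ : Algebra (FractionRing R) (FractionRing B) :=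
    (IsFractionRing.map (K := FractionRing R) (L := FractionRing B) (j := g.toRingHom)
      hg).toAlgebra
  let _ : Algebra (FractionRing A) (FractionRing B) :=
    ((algebraMap (FractionRing R) (FractionRing B)).comp
      (algebraMap (FractionRing A) (FractionRing R))).toAlgebra
  have : IsScalarTower (FractionRing A) (FractionRing R) (FractionRing B) :=
    IsScalarTower.of_algebraMap_eq fun _ => rfl
  have hAR : ∀ x, algebraMap (FractionRing A) (FractionRing R) (algebraMap A _ x) =
      algebraMap R _ (f x) := fun x => by
    rw [RingHom.algebraMap_toAlgebra, IsFractionRing.map, IsLocalization.map_eq]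
    rfl
  have hRB : ∀ x, algebraMap (FractionRing R) (FractionRing B) (algebraMap R _ x) =
      algebraMap B _ (g x) := fun x => by
    rw [RingHom.algebraMap_toAlgebra, IsFractionRing.map, IsLocalization.map_eq]
    rfl
  have hAB : ∀ x, algebraMap (FractionRing A) (FractionRing B) (algebraMap A _ x) =
      algebraMap B _ ((g.comp f) x) := fun x => by
    rw [IsScalarTower.algebraMap_apply (FractionRing A) (FractionRing R), hAR, hRB]
    rfl
  have : IsScalarTower k (FractionRing R) (FractionRing B) :=
    IsScalarTower.of_algebraMap_eq fun c => by
      rw [IsScalarTower.algebraMap_apply k R (FractionRing R), hRB, AlgHom.commutes,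
        ← IsScalarTower.algebraMap_apply]
  have : IsScalarTower k (FractionRing A) (FractionRing B) :=
    IsScalarTower.of_algebraMap_eq fun c => by
      rw [IsScalarTower.algebraMap_apply k A (FractionRing A), hAB, AlgHom.commutes,
        ← IsScalarTower.algebraMap_apply]
  refine ⟨inferInstance, hAR, Nat.eq_of_mul_eq_mul_right hn ?_⟩
  rw [← hA hAB, ← Module.finrank_mul_finrank (FractionRing A) (FractionRing R) (FractionRing B),
    hR hRB]

/-! ### Tuples of vectors on distinct lines of the cone -/

namespace ProjectiveVariety

variable {k : Type*} [Field k] {N : ℕ} (X : ProjectiveVariety k N)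

/-- The minor of the coordinates `a`, `b` of the factors `i`, `l` of the power of the cone. -/
def minor {ι : Type*} (a b : Fin (N + 1)) (i l : ι) : X.ConePowerRing ι :=
  X.conePowerCoord i a * X.conePowerCoord l b - X.conePowerCoord i b * X.conePowerCoord l a

/-- On the open set where this function does not vanish, the factors lie on distinct lines. -/
def discriminant {ι : Type*} [Fintype ι] [DecidableEq ι] (a b : Fin (N + 1)) : X.ConePowerRing ι :=
  ∏ p ∈ (Finset.univ : Finset ι).offDiag, X.minor a b p.1 p.2

/-- Two distinct points of `X` have a nonzero 2 × 2 minor. Putting one of them in the factor `i` and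
the other in all remaining factors shows that the same columns `a`, `b` serve every pair. -/
theorem exists_minor_ne_zero (hpos : X.points.Nontrivial) (ι : Type*) :
    ∃ a b, ∀ i l : ι, i ≠ l → X.minor a b i l ≠ 0 := by
  classical
  obtain ⟨p, hp, q, hq, hpq⟩ := hpos
  have hex : ∃ a b, p.rep a * q.rep b - p.rep b * q.rep a ≠ 0 := by
    by_contra! h
    obtain ⟨b, hb⟩ := Function.ne_iff.1 q.rep_nonzero
    refine hpq ?_
    rw [← p.mk_rep, ← q.mk_rep]
    refine (Projectivization.mk_eq_mk_iff' _ _ _ _ _).2 ⟨p.rep b / q.rep b, funext fun a => ?_⟩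
    have hb' : q.rep b ≠ 0 := hb
    rw [Pi.smul_apply, smul_eq_mul]
    field_simp
    linear_combination - h a b
  obtain ⟨a, b, hab⟩ := hex
  refine ⟨a, b, fun i l hil h => hab ?_⟩
  let c : X.conePower ι := ⟨fun r => if r.1 = i then p.rep r.2 else q.rep r.2, fun j => by
    by_cases hj : j = i
    · simp only [hj, if_true]; exact hp
    · simp only [hj, if_false]; exact hq⟩
  have := congrArg (X.evalConePower c) h
  simpa [minor, c, hil.symm] using this

section Discriminant

variable {ι : Type*} {a b : Fin (N + 1)}

/-- If two permutations act alike but differ at `i`, two different factors have the same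
coordinates, and their minor vanishes. -/
theorem injective_permAut (h : ∀ i l : ι, i ≠ l → X.minor a b i l ≠ 0) :
    Function.Injective (X.permAut (ι := ι)) := by
  intro σ τ hστ
  ext i
  by_contra hi
  have hc : ∀ j, X.conePowerCoord (σ i) j = X.conePowerCoord (τ i) j := fun j => by
    rw [← permAut_coord, hστ, permAut_coord]
  refine h _ _ hi ?_
  rw [minor, hc, hc]
  ring

variable [Fintype ι] [DecidableEq ι] (χ : X.ConePowerRing ι →ₐ[k] k)

theorem map_minor_ne_zero (hχ : χ (X.discriminant a b) ≠ 0) {i l : ι} (hil : i ≠ l) :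
    χ (X.conePowerCoord i a) * χ (X.conePowerCoord l b) -
      χ (X.conePowerCoord i b) * χ (X.conePowerCoord l a) ≠ 0 := by
  rw [discriminant, map_prod] at hχ
  simpa [minor] using Finset.prod_ne_zero_iff.1 hχ (i, l) (by simpa using hil)

theorem algHom_coord_ne_zero [Nontrivial ι] (hχ : χ (X.discriminant a b) ≠ 0)
    (i : ι) :
    (fun j => χ (X.conePowerCoord i j)) ≠ 0 := by
  intro h
  -- A second factor is needed: with only one, the discriminant is an empty product and says
  -- nothing.
  obtain ⟨l, hl⟩ := exists_ne i
  have h' : ∀ j, χ (X.conePowerCoord i j) = 0 := congrFun h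
  exact X.map_minor_ne_zero χ hχ hl.symm (by simp [h'])

theorem algHom_coord_injective [Nontrivial ι] (hχ : χ (X.discriminant a b) ≠ 0) :
    Function.Injective fun i =>
    Projectivization.mk k (fun j => χ (X.conePowerCoord i j))
      (X.algHom_coord_ne_zero χ hχ i) := by
  intro i l h
  by_contra hil
  obtain ⟨c, hc⟩ := (Projectivization.mk_eq_mk_iff' _ _ _ _ _).1 h
  have hc' : ∀ j, χ (X.conePowerCoord i j) = c * χ (X.conePowerCoord l j) :=
    fun j => (congrFun hc j).symm
  exact X.map_minor_ne_zero χ hχ hil (by rw [hc', hc']; ring)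

end Discriminant

theorem ruledJoinRing_algHom_ext (Y : ProjectiveVariety k N) {C : Type*} [CommRing C] [Algebra k C]
    {f g : RuledJoinRing X Y →ₐ[k] C} (hl : ∀ j, f (X.coord j ⊗ₜ 1) = g (X.coord j ⊗ₜ 1))
    (hr : ∀ j, f (1 ⊗ₜ Y.coord j) = g (1 ⊗ₜ Y.coord j)) : f = g :=
  Algebra.TensorProduct.ext (X.coordRing_algHom_ext hl)
    (Y.coordRing_algHom_ext (f := (f.restrictScalars k).comp Algebra.TensorProduct.includeRight)
      (g := (g.restrictScalars k).comp Algebra.TensorProduct.includeRight) hr)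

/-! ### The cover of the ruled join by the cube of the cone -/

variable [IsAlgClosed k]

/-- The map `C³ → cone(σ₂)`, `(p, q, r) ↦ -(q + r)`, where `C` is the cone over `X`, on
coordinate rings. -/
def secantHom : (X.secantVariety 2).coordRing →ₐ[k] X.ConePowerRing (Fin 3) :=
  Ideal.Quotient.liftₐ (X.secantVariety 2).ideal
    -- This is `-(q + r)`, written as the first factor minus the total sum, so that invariance under
    -- permutations fixing the factor `0` is evident. The sign makes the difference map of the join
    -- give `p + q + r`.
    (MvPolynomial.aeval fun j => X.conePowerCoord 0 j - ∑ i, X.conePowerCoord i j)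
    fun f hf => by
      let g : MvPolynomial (Fin 3 × Fin (N + 1)) k :=
        MvPolynomial.aeval (fun j => MvPolynomial.X (0, j) - ∑ i, MvPolynomial.X (i, j)) f
      have hg : MvPolynomial.aeval
          (fun j => X.conePowerCoord 0 j - ∑ i : Fin 3, X.conePowerCoord i j) f =
            Ideal.Quotient.mkₐ k (X.conePowerIdeal (Fin 3)) g := by
        simp only [g]
        rw [← AlgHom.comp_apply]
        congr 1
        exact MvPolynomial.algHom_ext fun j => by simp [conePowerCoord]
      rw [hg]
      refine Ideal.Quotient.eq_zero_iff_mem.2 fun v hv => ?_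
      have hv' : MvPolynomial.aeval v g = MvPolynomial.aeval
          (∑ i : Fin 2, (-1 : k) • fun j => v (i.succ, j)) f := by
        simp only [g]
        rw [← AlgHom.comp_apply]
        congr 1
        refine MvPolynomial.algHom_ext fun j => ?_
        simp [Fin.sum_univ_succ]
      rw [hv']
      exact (mem_joinOfFamily_ideal_iff _ f).1 hf _ fun i => X.smul_mem_cone _ (hv i.succ)

@[simp]
theorem secantHom_coord (j : Fin (N + 1)) :
    X.secantHom ((X.secantVariety 2).coord j) =
      X.conePowerCoord 0 j - ∑ i, X.conePowerCoord i j := by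
  change MvPolynomial.aeval _ (MvPolynomial.X j) = _
  simp

/-- The map `C³ → C × cone(σ₂)`, `(p, q, r) ↦ (p, -(q + r))`, where `C` is the cone over `X`, on
coordinate rings. -/
def symmetrization : RuledJoinRing X (X.secantVariety 2) →ₐ[k] X.ConePowerRing (Fin 3) :=
  Algebra.TensorProduct.lift (X.coordHom 0) X.secantHom fun _ _ => Commute.all _ _

@[simp]
theorem symmetrization_left (j : Fin (N + 1)) :
    X.symmetrization (X.coord j ⊗ₜ 1) = X.conePowerCoord 0 j := by
  simp [symmetrization]

@[simp]
theorem symmetrization_right (j : Fin (N + 1)) :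
    X.symmetrization (1 ⊗ₜ (X.secantVariety 2).coord j) =
      X.conePowerCoord 0 j - ∑ i, X.conePowerCoord i j := by
  simp [symmetrization]

theorem symmetrization_additionMap (j : Fin (N + 1)) :
    X.symmetrization (additionMap X (X.secantVariety 2)
      ((embeddedJoin X (X.secantVariety 2)).coord j)) = ∑ i, X.conePowerCoord i j := by
  change X.symmetrization (substDiff X (X.secantVariety 2) (MvPolynomial.X j)) = _
  simp [substDiff]

/-- This is dominance: the image of `C³` contains every `(v, c 0 + c 1)` with `v`, `c 0`, `c 1` in
`C`, and the sums `c 0 + c 1` are dense in the cone over `σ₂`. -/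
theorem symmetrization_injective : Function.Injective X.symmetrization := by
  rw [injective_iff_map_eq_zero]
  intro t ht
  refine eq_zero_of_evalLeft X _ t fun v => ?_
  obtain ⟨f, hf⟩ := (X.secantVariety 2).toCoordRing_surjective (evalLeft X _ v t)
  rw [← hf, toCoordRing_eq_zero_iff, secantVariety, mem_joinOfFamily_ideal_iff]
  intro c hc
  let w : (X.secantVariety 2).cone := ⟨∑ i, c i, sum_mem_joinOfFamily_cone _ hc⟩
  let d : X.conePower (Fin 3) := ⟨fun p => (![v.1, (-1 : k) • c 0, (-1 : k) • c 1] : Fin 3 → _) p.1 p.2,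
    fun i => by
      fin_cases i
      exacts [v.2, X.smul_mem_cone _ (hc 0), X.smul_mem_cone _ (hc 1)]⟩
  have key : (X.evalConePower d).comp X.symmetrization =
      ((X.secantVariety 2).evalAt w).comp (evalLeft X (X.secantVariety 2) v) := by
    refine X.ruledJoinRing_algHom_ext _ (fun j => ?_) fun j => ?_
    · rw [AlgHom.comp_apply, symmetrization_left]
      simp [d, evalLeft, coord, Algebra.ofId_apply]
    · rw [AlgHom.comp_apply, symmetrization_right]
      simp [d, w, evalLeft, coord, Algebra.ofId_apply, Fin.sum_univ_succ, add_comm]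
  have := DFunLike.congr_fun key t
  rw [AlgHom.comp_apply, ht, map_zero, AlgHom.comp_apply, ← hf, evalAt_toCoordRing] at this
  exact this.symm

/-! ### The two degrees, and their quotient -/

/-- Serves both quotients of `C³`. By `hsum` a fibre fixes the sum of the three vectors, so off the
discriminant it lies in an `S₃`-orbit; `hfib` then restricts the permutation to `H`. -/
theorem finrank_eq_card_of_perm [CharZero k] {a b : Fin (N + 1)}
    (hab : ∀ i l : Fin 3, i ≠ l → X.minor a b i l ≠ 0) {A E F : Type*} [CommRing A] [IsDomain A]
    [Algebra k A] [Field E] [Field F] [Algebra A E] [IsFractionRing A E]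
    [Algebra (X.ConePowerRing (Fin 3)) F] [IsFractionRing (X.ConePowerRing (Fin 3)) F] [Algebra k E]
    [Algebra k F] [Algebra E F] [IsScalarTower k E F] [IsScalarTower k (X.ConePowerRing (Fin 3)) F]
    (hemb : X.IsCompletelyEmbedded) (hva : X.IsVeryAmple 5)
    (φ : A →ₐ[k] X.ConePowerRing (Fin 3))
    (hEF : ∀ x, algebraMap E F (algebraMap A E x) = algebraMap _ F (φ x))
    (H : Subgroup (Equiv.Perm (Fin 3))) (hH : ∀ σ ∈ H, ∀ x, X.permAut σ (φ x) = φ x)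
    (hsum : ∀ j, ∃ x, φ x = ∑ i, X.conePowerCoord i j)
    (hfib : ∀ (σ : Equiv.Perm (Fin 3)) (χ ψ : X.ConePowerRing (Fin 3) →ₐ[k] k),
      χ (X.discriminant a b) ≠ 0 → (∀ x, χ (φ x) = ψ (φ x)) →
        (∀ i j, ψ (X.conePowerCoord i j) = χ (X.conePowerCoord (σ i) j)) → σ ∈ H) :
    Module.finrank E F = Nat.card H := by
  have hg : X.discriminant a b ≠ (0 : X.ConePowerRing (Fin 3)) :=
    Finset.prod_ne_zero_iff.2 fun p hp => hab _ _ (by simpa using hp)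
  rw [Nat.card_congr (H.equivMapOfInjective X.permAut (X.injective_permAut hab)).toEquiv]
  have : Finite (H.map (X.permAut (ι := Fin 3))) := Finite.of_equiv H
    (H.equivMapOfInjective X.permAut (X.injective_permAut hab)).toEquiv
  refine finrank_eq_card_of_fibres φ hEF (H.map X.permAut) ?_ hg fun χ ψ hχψ hχ hψ => ?_
  · rintro _ ⟨σ, hσ, rfl⟩ x
    exact hH σ hσ x
  -- The inequality `3 + 3 ≤ 5 + 1` is where 5-very ampleness is exactly what is needed.
  · obtain ⟨σ, hσ⟩ := X.exists_perm_of_sum_eq hemb hva (ι := Fin 3) (by simp)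
      (X.algHom_mem_cone χ) (X.algHom_mem_cone ψ) (X.algHom_coord_ne_zero χ hχ)
      (X.algHom_coord_ne_zero ψ hψ) (X.algHom_coord_injective χ hχ)
      (X.algHom_coord_injective ψ hψ) (funext fun j => by
        obtain ⟨x, hx⟩ := hsum j
        have := hχψ x
        rw [hx, map_sum, map_sum] at this
        simpa [Finset.sum_apply] using this)
    have hσ' : ∀ i j, ψ (X.conePowerCoord i j) = χ (X.conePowerCoord (σ i) j) :=
      fun i j => congrFun (hσ i) j
    refine ⟨X.permAut σ, ⟨σ, hfib σ χ ψ hχ hχψ hσ', rfl⟩, fun y => ?_⟩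
    have : ψ = χ.comp (X.permAut σ).toAlgHom := X.conePowerRing_algHom_ext fun i j => by
      simpa using hσ' i j
    rw [this]
    rfl

theorem joinDegree_secantVariety_two [CharZero k] (hpos : X.points.Nontrivial)
    (hemb : X.IsCompletelyEmbedded) (hva : X.IsVeryAmple 5) :
    X.joinDegree (X.secantVariety 2) = 3 := by
  obtain ⟨a, b, hab⟩ := X.exists_minor_ne_zero hpos (Fin 3)
  have hsumA : ∀ j, (X.symmetrization.comp (additionMap X (X.secantVariety 2)))
      ((embeddedJoin X (X.secantVariety 2)).coord j) = ∑ i, X.conePowerCoord i j :=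
    X.symmetrization_additionMap
  have hsumσ : ∀ (σ : Equiv.Perm (Fin 3)) j, X.permAut σ (∑ i, X.conePowerCoord i j) =
      ∑ i, X.conePowerCoord i j := fun σ j => by
    rw [map_sum]
    simp only [permAut_coord]
    exact Equiv.sum_comp σ fun i => X.conePowerCoord i j
  -- The group is `S₃`, of order `3 * 2`, over the embedded join, and the stabilizer of the factor
  -- `0`, of order 2, over the ruled join.
  obtain ⟨_, hAR, h3⟩ := exists_algebra_finrank_eq (m := 3) (n := 2)
    (additionMap X (X.secantVariety 2)) (additionMap_injective X _) X.symmetrization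
    X.symmetrization_injective two_pos (fun hAB => by
      rw [X.finrank_eq_card_of_perm hab hemb hva (X.symmetrization.comp (additionMap X _)) hAB ⊤
        (fun σ _ x => ?_) (fun j => ⟨_, hsumA j⟩) (fun σ _ _ _ _ _ => Subgroup.mem_top σ)]
      · rw [Nat.card_congr Subgroup.topEquiv.toEquiv, Nat.card_perm, Nat.card_eq_fintype_card]
        rfl
      · have : (X.permAut σ).toAlgHom.comp (X.symmetrization.comp (additionMap X _)) =
            X.symmetrization.comp (additionMap X _) :=
          coordRing_algHom_ext _ fun j => by
            rw [AlgHom.comp_apply, hsumA]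
            exact hsumσ σ j
        exact DFunLike.congr_fun this x) (fun hRB => by
      rw [X.finrank_eq_card_of_perm hab hemb hva X.symmetrization hRB
        (MulAction.stabilizer (Equiv.Perm (Fin 3)) (0 : Fin 3)) (fun σ hσ x => ?_)
        (fun j => ⟨_, hsumA j⟩) (fun σ χ ψ hχ hχψ hσ => ?_)]
      · rw [Nat.card_eq_fintype_card]
        decide
      · have hσ0 : σ 0 = 0 := hσ
        have : (X.permAut σ).toAlgHom.comp X.symmetrization = X.symmetrization := by
          refine X.ruledJoinRing_algHom_ext _ (fun j => ?_) fun j => ?_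
          · simp [hσ0]
          · rw [AlgHom.comp_apply, symmetrization_right, map_sub]
            exact congrArg₂ _ (by simp [hσ0]) (hsumσ σ j)
        exact DFunLike.congr_fun this x
      -- The ruled join remembers the factor `0`, so the factors `0` and `σ 0` of `χ` are the same
      -- vector; off the discriminant different factors lie on different lines, whence `σ 0 = 0`.
      · refine X.algHom_coord_injective χ hχ ?_
        refine (Projectivization.mk_eq_mk_iff' _ _ _ _ _).2 ⟨1, funext fun j => ?_⟩
        change (1 : k) * χ (X.conePowerCoord 0 j) = χ (X.conePowerCoord (σ 0) j)
        rw [one_mul, ← hσ, ← symmetrization_left, hχψ])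
  have : FiniteDimensional (FractionRing (embeddedJoin X (X.secantVariety 2)).coordRing)
      (FractionRing (RuledJoinRing X (X.secantVariety 2))) :=
    Module.finite_of_finrank_pos (by rw [h3]; exact three_pos)
  obtain ⟨i, hi⟩ := (embeddedJoin X (X.secantVariety 2)).exists_X_notMem
  rw [← h3]
  exact GradedDomain.rationalMapDegree_eq_finrank _ _ _ _ _ (iSup_piece _)
    (iSup_ruledJoinPiece X _) (iSupIndep_ruledJoinPiece X _) (coord_mem_piece _ i)
    (fun h => hi ((toCoordRing_eq_zero_iff _ _).1 h)) hAR

end ProjectiveVariety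

end

theorem mainTheorem5 {k : Type*} [Field k] [IsAlgClosed k] [CharZero k] {N : ℕ}
    (X : ProjectiveVariety k N)
    (hpos : X.points.Nontrivial)
    (hns : X.IsNonsingular)
    (hemb : X.IsCompletelyEmbedded)
    (hva : X.IsVeryAmple 5) :
    X.embeddedJoin (X.secantVariety 2) = X.secantVariety 3 ∧
      X.joinDegree (X.secantVariety 2) = 3 :=
  ⟨X.embeddedJoin_secantVariety_two, X.joinDegree_secantVariety_two hpos hemb hva⟩
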